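/- **Conventions.** Let $V$ be a finite set, $\mathbb K$ a field, $R=\mathbb K[x_v : v\in V]$, and let $\Delta$ be a simplicial complex on $V$ (the empty face plays no role: facets are maximal nonempty faces, the complex without facets is allowed, and not every element of $V$ has to be a vertex of $\Delta$). Let $\mathcal F(\Delta)$ be the set of facets of $\Delta$. For $S\subseteq V$ put $\mathbf x_S=\prod_{v\in S}x_v$, and let $I(\Delta)=\langle \mathbf x_F : F\in\mathcal F(\Delta)\rangle\subseteq R$ be the facet ideal. A subcomplex of $\Delta$ means a complex $\Gamma$ with $\mathcal F(\Gamma)\subseteq\mathcal F(\Delta)$. A facet $F$ of $\Delta$ is a leaf if it is the only facet, or if there is a facet $G\ne F$ with $F\cap H\subseteq F\cap G$ for all facets $H\neq F$. A simplicial complex is connected if any two facets are joined by a chain of facets in which consecutive ones intersect; a connected complex is a simplicial tree if each of its subcomplexes with at least one facet has a leaf; $\Delta$ is a simplicial forest if every connected component of it is a simplicial tree. A simplicial forest $\Delta$ is Cohen–Macaulay (over $\mathbb K$) if $R/I(\Delta)$ is Cohen–Macaulay, i.e. $\operatorname{depth}(R/I(\Delta))=\dim (R/I(\Delta))$, where depth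 is taken with respect to the graded maximal ideal of $R$. The matching number $\nu(\Delta)$ is the maximal number of pairwise disjoint facets of $\Delta$. For a square-free monomial ideal $I$ and $k\ge 0$, the $k$-th square-free power $I^{[k]}$ is the ideal generated by the square-free monomials in $I^k$; in particular $I^{[0]}=R$. For a facet $F$ let $\mathcal N_\Delta[F]=\{F\}\cup\{H\in\mathcal F(\Delta): H\cap F\ne\emptyset\}$. **Lemma (colon lemma).** Let $\Delta$ be a Cohen–Macaulay simplicial forest, let $F$ be a leaf of $\Delta$, and let $\Delta_1$ be the subcomplex of $\Delta$ with $\mathcal F(\Delta_1)=\mathcal F(\Delta)\setminus\mathcal N_\Delta[F]$. Then for all $1\le k\le\nu(\Delta)$, $$\bigl(I(\Delta)^{[k]}:\mathbf x_F\bigr)=I(\Delta_1)^{[k-1]}$$ as ideals of $R$. Moreover, $\Delta_1$ is also a Cohen–Macaulay simplicial forest. -/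

import Mathlib

namespace FacetComplex

/-- The facets of a simplicial complex: its maximal faces. (The faces of a
`PreAbstractSimplicialComplex` are its nonempty faces; the empty face is left implicit. The
elements of `V` need not all be vertices of the complex.) -/
def facets {V : Type*} (D : PreAbstractSimplicialComplex V) : Set (Finset V) :=
  {F | Maximal (fun s => s ∈ D.faces) F}

/-- `⟨F : F ∈ S⟩`: the complex of all nonempty subsets of members of `S`. -/
def generated {V : Type*} (S : Set (Finset V)) : PreAbstractSimplicialComplex V where
  faces := {s | s.Nonempty ∧ ∃ F ∈ S, s ⊆ F}
  isRelLowerSet_faces := by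
    rintro s ⟨hs, F, hF, hsF⟩
    exact ⟨hs, fun t hts ht => ⟨ht, F, hF, hts.trans hsF⟩⟩

/-- `G` is a subcomplex of `D` in the sense used for facet ideals: its facets are facets of `D`. -/
def IsSubcomplex {V : Type*} (G D : PreAbstractSimplicialComplex V) : Prop :=
  facets G ⊆ facets D

/-- The facet `F` is a leaf: it is the only facet, or there is a facet `G ≠ F` (a joint of `F`)
with `F ∩ H ⊆ F ∩ G` for all facets `H ≠ F`. -/
def IsLeaf {V : Type*} [DecidableEq V] (D : PreAbstractSimplicialComplex V) (F : Finset V) :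
    Prop :=
  F ∈ facets D ∧
    (facets D = {F} ∨
      ∃ G ∈ facets D, G ≠ F ∧ ∀ H ∈ facets D, H ≠ F → F ∩ H ⊆ F ∩ G)

/-- Any two facets are joined by a chain of facets in which consecutive ones intersect. -/
def IsConnected {V : Type*} [DecidableEq V] (D : PreAbstractSimplicialComplex V) : Prop :=
  ∀ F ∈ facets D, ∀ G ∈ facets D,
    Relation.ReflTransGen (fun A B => B ∈ facets D ∧ (A ∩ B).Nonempty) F G

/-- A connected component: a maximal nonempty connected subcomplex. -/
def IsComponent {V : Type*} [DecidableEq V] (G D : PreAbstractSimplicialComplex V) : Prop :=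
  Maximal (fun C => IsSubcomplex C D ∧ (facets C).Nonempty ∧ IsConnected C) G

/-- A simplicial tree: connected, and every nonempty subcomplex has a leaf. -/
def IsTree {V : Type*} [DecidableEq V] (D : PreAbstractSimplicialComplex V) : Prop :=
  IsConnected D ∧ ∀ G, IsSubcomplex G D → (facets G).Nonempty → ∃ F, IsLeaf G F

/-- A simplicial forest: every connected component is a simplicial tree. -/
def IsForest {V : Type*} [DecidableEq V] (D : PreAbstractSimplicialComplex V) : Prop :=
  ∀ G, IsComponent G D → IsTree G

/-- The closed neighborhood `N[F]`: `F` together with all facets that meet `F`. -/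
def closedNeighborhood {V : Type*} [DecidableEq V] (D : PreAbstractSimplicialComplex V)
    (F : Finset V) : Set (Finset V) :=
  {H | H = F ∨ (H ∈ facets D ∧ (H ∩ F).Nonempty)}

/-- The subcomplex whose facets are the facets of `D` outside `N[F]`. -/
def deleteClosedNeighborhood {V : Type*} [DecidableEq V] (D : PreAbstractSimplicialComplex V)
    (F : Finset V) : PreAbstractSimplicialComplex V :=
  generated (facets D \ closedNeighborhood D F)

theorem facets_deleteClosedNeighborhood {V : Type*} [DecidableEq V]
    (D : PreAbstractSimplicialComplex V) (F : Finset V) :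
    facets (deleteClosedNeighborhood D F) = facets D \ closedNeighborhood D F := by
  ext A
  constructor
  · rintro ⟨⟨hA, B, hB, hAB⟩, hmax⟩
    have hBne : B.Nonempty := hA.mono hAB
    have : B ⊆ A := hmax (y := B) ⟨hBne, B, hB, subset_rfl⟩ hAB
    rwa [Finset.Subset.antisymm hAB this]
  · intro hA
    refine ⟨⟨(D.isRelLowerSet_faces hA.1.1).1, A, hA, subset_rfl⟩, ?_⟩
    rintro B ⟨_, C, hC, hBC⟩ hAB
    exact hBC.trans (hA.1.2 hC.1.1 (le_trans hAB hBC))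

/-- The matching number: the largest number of pairwise disjoint facets. -/
noncomputable def matchingNumber {V : Type*} (D : PreAbstractSimplicialComplex V) : ℕ :=
  sSup {n | ∃ M : Finset (Finset V), (M : Set (Finset V)) ⊆ facets D ∧
    (M : Set (Finset V)).PairwiseDisjoint id ∧ M.card = n}

/-- The square-free monomial `x_S`, the product of the variables in `S`. -/
noncomputable def monomialOf {V : Type*} (K : Type*) [Field K] (S : Finset V) :
    MvPolynomial V K :=
  ∏ v ∈ S, MvPolynomial.X v

/-- The facet ideal `I(D)`, generated by the `x_F` for the facets `F`. -/
noncomputable def facetIdeal {V : Type*} (K : Type*) [Field K]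
    (D : PreAbstractSimplicialComplex V) : Ideal (MvPolynomial V K) :=
  Ideal.span (monomialOf K '' facets D)

/-- The `k`-th square-free power `I^[k]`, generated by the square-free monomials in `I ^ k`;
for `k = 0` it is the whole ring. -/
noncomputable def squarefreePower {V K : Type*} [Field K] (I : Ideal (MvPolynomial V K))
    (k : ℕ) : Ideal (MvPolynomial V K) :=
  Ideal.span {p | p ∈ I ^ k ∧ ∃ S : Finset V, p = monomialOf K S}

/-- The depth of `R ⧸ I`: the supremum of the lengths of the `R ⧸ I`-regular sequences in the
graded maximal ideal of the polynomial ring `R`. -/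
noncomputable def depthQuotient {V K : Type*} [Field K] (I : Ideal (MvPolynomial V K)) :
    WithBot ℕ∞ :=
  ⨆ rs ∈ {rs : List (MvPolynomial V K) | (∀ r ∈ rs, r ∈ MvPolynomial.idealOfVars V K) ∧
    RingTheory.Sequence.IsRegular (MvPolynomial V K ⧸ I) rs}, ((rs.length : ℕ∞) : WithBot ℕ∞)

/-- For a homogeneous ideal `I`, the graded ring `R ⧸ I` is Cohen-Macaulay: its depth equals its
Krull dimension. -/
def IsCohenMacaulayQuotient {V K : Type*} [Field K] (I : Ideal (MvPolynomial V K)) : Prop :=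
  depthQuotient I = ringKrullDim (MvPolynomial V K ⧸ I)

/-- A Cohen-Macaulay simplicial forest (over `K`): a simplicial forest `D` for which the quotient
of the polynomial ring by the facet ideal is Cohen-Macaulay. (Variables outside the vertex set of
`D` raise depth and dimension equally, so they do not matter.) -/
def IsCohenMacaulayForest {V : Type*} [DecidableEq V] (K : Type*) [Field K]
    (D : PreAbstractSimplicialComplex V) : Prop :=
  IsForest D ∧ IsCohenMacaulayQuotient (facetIdeal K D)

end FacetComplex

/-! The proof rests on the fact that a Cohen–Macaulay simplicial forest is grafted (`IsGrafting`):
some family L of pairwise disjoint facets covers all vertices, and all facets cut out a chain in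
each member of L. A leaf has a vertex lying in no other facet, so it belongs to L.

For F in L, two facets that meet F have nested traces on F and hence intersect. So a matching has at
most one member meeting F. Dropping it from a k-matching leaves k - 1 facets disjoint from F;
conversely, F can be added to a matching of facets disjoint from F. This is the colon formula
(`colon_squarefreePower`), since square-free powers are monomial ideals governed by matchings.
Removing F from L grafts the deleted complex, so its Cohen–Macaulayness follows from the converse
fact that grafted complexes are Cohen–Macaulay.

Cohen–Macaulay implies grafted: a minimal vertex cover C gives depth at most |V| - |C|, while any
cover C' gives dimension at least |V| - |C'|, so minimal covers all have the same size. By König's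
theorem for forests this size is that of some matching M, so each minimal cover has exactly one
vertex in each member of M and none elsewhere. Suitable minimal covers then show that M is a
grafting (`HasLeaves.exists_isGrafting`).

Grafted implies Cohen–Macaulay: the dimension is at most |V| - |L|, and identifying the variables of
each block with one root variable gives a regular sequence of that length (`exists_isRegular`). -/

open MvPolynomial

/-! ### Regular sequences and the dimension of quotients by primes. -/

theorem ringKrullDim_quotient_add_one_le_of_lt {R : Type*} [CommRing R] {P Q : Ideal R}
    [P.IsPrime] {x : R} (hPQ : P ≤ Q) (hxP : x ∉ P) (hxQ : x ∈ Q) :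
    ringKrullDim (R ⧸ Q) + 1 ≤ ringKrullDim (R ⧸ P) := by
  have hx : Ideal.Quotient.mk P x ∈ nonZeroDivisors (R ⧸ P) := by
    rw [mem_nonZeroDivisors_iff_ne_zero]
    rwa [Ne, Ideal.Quotient.eq_zero_iff_mem]
  refine le_trans ?_ (ringKrullDim_quotient_succ_le_of_nonZeroDivisor hx)
  gcongr
  let f : (R ⧸ P) ⧸ Ideal.span {Ideal.Quotient.mk P x} →+* R ⧸ Q :=
    Ideal.Quotient.lift _ (Ideal.Quotient.factor hPQ) (by
      intro a ha
      obtain ⟨b, rfl⟩ := Ideal.mem_span_singleton'.1 ha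
      rw [map_mul, Ideal.Quotient.factor_mk, Ideal.Quotient.eq_zero_iff_mem.2 hxQ, mul_zero])
  refine ringKrullDim_le_of_surjective f ?_
  exact Ideal.Quotient.lift_surjective_of_surjective _ _ (Ideal.Quotient.factor_surjective hPQ)

/-- A Nakayama-type statement: `x` in a prime `m` cannot make everything killed by `P` divisible. -/
theorem exists_torsion_not_divisible {R M : Type*} [CommRing R] [AddCommGroup M] [Module R M]
    [IsNoetherian R M] {m P : Ideal R} [m.IsPrime] {x : R} (hx : IsSMulRegular M x) (hxm : x ∈ m)
    {u : M} (hP : ∀ r ∈ P, r • u = 0) (hu : ∀ r : R, r • u = 0 → r ∈ m) :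
    ∃ n : M, (∀ r ∈ P, r • n = 0) ∧ ∀ (r : R) (y : M), r • n = x • y → r ∈ m := by
  by_contra! hcon
  -- `sat n` is the preimage of the submodule generated by n in the localization at m. If n were
  -- always divisible by x up to a factor outside m, the quotient y would have a strictly larger
  -- saturation, contradicting the ascending chain condition.
  let sat : M → Submodule R M := fun n =>
    { carrier := {y | ∃ s, s ∉ m ∧ ∃ c : R, s • y = c • n}
      add_mem' := by
        rintro a b ⟨s, hs, c, h⟩ ⟨s', hs', c', h'⟩
        refine ⟨s * s', fun hh => (Ideal.IsPrime.mem_or_mem ‹_› hh).elim hs hs',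
          s' * c + s * c', ?_⟩
        rw [smul_add, add_smul, mul_smul s' c, ← h, mul_smul s c', ← h', smul_smul, smul_smul,
          mul_comm s' s]
      zero_mem' := ⟨1, fun h => Ideal.IsPrime.ne_top ‹_› ((Ideal.eq_top_iff_one m).2 h), 0, by simp⟩
      smul_mem' := by
        rintro r a ⟨s, hs, c, h⟩
        exact ⟨s, hs, r * c, by rw [smul_comm, h, mul_smul]⟩ }
  let T : Set M := {n | (∀ r ∈ P, r • n = 0) ∧ ∀ r : R, r • n = 0 → r ∈ m}
  obtain ⟨N, ⟨n, hn, rfl⟩, hmax⟩ :=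
    WellFounded.has_min (wellFounded_gt (α := Submodule R M)) (sat '' T) ⟨_, u, ⟨hP, hu⟩, rfl⟩
  obtain ⟨s, y, hsy, hs⟩ := hcon n hn.1
  have hyT : y ∈ T := by
    refine ⟨fun r hr => hx ?_, fun r hr => ?_⟩
    · simp only [smul_zero]
      rw [smul_comm, ← hsy, smul_comm, hn.1 r hr, smul_zero]
    · have : (r * s) • n = 0 := by rw [mul_smul, hsy, smul_comm, hr, smul_zero]
      exact (Ideal.IsPrime.mem_or_mem ‹_› (hn.2 _ this)).resolve_right hs
  refine hmax (sat y) ⟨y, hyT, rfl⟩ (lt_of_le_of_ne ?_ ?_)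
  · rintro z ⟨s', hs', c, hz⟩
    refine ⟨s * s', fun hh => (Ideal.IsPrime.mem_or_mem ‹_› hh).elim hs hs', c * x, ?_⟩
    rw [mul_smul, hz, smul_comm, hsy, smul_smul]
  · intro heq
    have hmem : y ∈ sat n := by
      rw [heq]
      exact ⟨1, fun h => Ideal.IsPrime.ne_top ‹_› ((Ideal.eq_top_iff_one m).2 h), 1, rfl⟩
    obtain ⟨s', hs', c, h⟩ := hmem
    have h0 : (s * s' - c * x) • y = 0 := by
      rw [sub_smul, mul_smul, h, mul_smul c, ← hsy, smul_comm, sub_self]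
    have h1 := m.add_mem (hyT.2 _ h0) (m.mul_mem_left c hxm)
    rw [sub_add_cancel] at h1
    exact (Ideal.IsPrime.mem_or_mem ‹_› h1).elim hs hs'

/-- Induction on the sequence: the torsion element survives modulo x as an element q whose
annihilator contains P and x and lies in m. A minimal prime Q of that annihilator inside m is
associated, so it serves the rest of the sequence, and it strictly contains P because x is not in P.
-/
theorem length_le_ringKrullDim_quotient_of_isWeaklyRegular {R : Type*} [CommRing R]
    [IsNoetherianRing R] {m : Ideal R} [m.IsPrime] (rs : List R) :
    ∀ (M : Type*) [AddCommGroup M] [Module R M] [Module.Finite R M] (P : Ideal R) [P.IsPrime]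
      (u : M), (∀ r ∈ P, r • u = 0) → (∀ r : R, r • u = 0 → r ∈ m) → (∀ r ∈ rs, r ∈ m) →
      RingTheory.Sequence.IsWeaklyRegular M rs →
      ((rs.length : ℕ∞) : WithBot ℕ∞) ≤ ringKrullDim (R ⧸ P) := by
  induction rs with
  | nil =>
    intro M _ _ _ P _ u _ _ _ _
    simpa using ringKrullDim_nonneg_of_nontrivial
  | cons x rs ih =>
    intro M _ _ _ P _ u hP hu hm hreg
    rw [RingTheory.Sequence.isWeaklyRegular_cons_iff] at hreg
    obtain ⟨hx, hreg⟩ := hreg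
    have hxm : x ∈ m := hm x (by simp)
    have hxP : x ∉ P := by
      intro h
      have : u = 0 := hx (by simpa using hP x h)
      refine Ideal.IsPrime.ne_top ‹m.IsPrime› ((Ideal.eq_top_iff_one m).2 (hu 1 ?_))
      simp [this]
    obtain ⟨n, hn, hnm⟩ := exists_torsion_not_divisible hx hxm hP hu
    let q : QuotSMulTop x M := Submodule.Quotient.mk n
    have hq : ∀ r : R, r • q = 0 ↔ ∃ y, r • n = x • y := by
      intro r
      change Submodule.Quotient.mk (r • n) = 0 ↔ _
      rw [Submodule.Quotient.mk_eq_zero, Submodule.mem_smul_pointwise_iff_exists]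
      constructor
      · rintro ⟨y, -, h⟩
        exact ⟨y, h.symm⟩
      · rintro ⟨y, h⟩
        exact ⟨y, trivial, h.symm⟩
    let A : Ideal R := (R ∙ q).annihilator
    have hA : ∀ r, r ∈ A ↔ r • q = 0 := fun r => Submodule.mem_annihilator_span_singleton q r
    have hAm : A ≤ m := fun r hr => by
      obtain ⟨y, hy⟩ := (hq r).1 ((hA r).1 hr)
      exact hnm r y hy
    obtain ⟨Q, hQ, hQm⟩ := Ideal.exists_minimalPrimes_le hAm
    have hass := Module.associatedPrimes.minimalPrimes_annihilator_subset_associatedPrimes R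
      (R ∙ q) hQ
    obtain ⟨hQp, w, hw⟩ := isAssociatedPrime_iff.1 hass
    have hw' : ∀ r, r ∈ Q ↔ r • (w : QuotSMulTop x M) = 0 := by
      intro r
      rw [hw, Submodule.mem_colon_singleton, Submodule.mem_bot, ← Submodule.coe_smul,
        Submodule.coe_eq_zero]
    have hlen := ih (QuotSMulTop x M) Q (w : QuotSMulTop x M) (fun r hr => (hw' r).1 hr)
      (fun r hr => hQm ((hw' r).2 hr)) (fun r hr => hm r (by simp [hr])) hreg
    refine le_trans ?_ (ringKrullDim_quotient_add_one_le_of_lt (Q := Q) (x := x) ?_ hxP ?_)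
    · simp only [List.length_cons]
      push_cast
      exact add_le_add_left hlen 1
    · exact fun r hr => hQ.1.2 ((hA r).2 ((hq r).2 ⟨0, by rw [hn r hr, smul_zero]⟩))
    · exact hQ.1.2 ((hA x).2 ((hq x).2 ⟨n, rfl⟩))

/-- A chain of primes over I starts at some Q, so it lies entirely above the prescribed P ≤ Q. -/
theorem ringKrullDim_quotient_le_of_forall_prime {R : Type*} [CommRing R] {I : Ideal R}
    {d : WithBot ℕ∞}
    (h : ∀ Q : Ideal R, Q.IsPrime → I ≤ Q → ∃ P : Ideal R, P ≤ Q ∧ ringKrullDim (R ⧸ P) ≤ d) :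
    ringKrullDim (R ⧸ I) ≤ d := by
  rw [ringKrullDim_quotient, Order.krullDim]
  refine iSup_le fun p => ?_
  obtain ⟨P, hPQ, hP⟩ := h p.head.1.asIdeal p.head.1.isPrime p.head.2
  refine le_trans ?_ hP
  rw [ringKrullDim_quotient]
  let q : LTSeries (PrimeSpectrum.zeroLocus (P : Set R)) :=
    { length := p.length
      toFun := fun i => ⟨(p i).1, fun r hr =>
        (show p.head ≤ p i from LTSeries.head_le p i) (hPQ hr)⟩
      step := fun i => p.step i }
  exact Order.LTSeries.length_le_krullDim q

/-! ### Ideals generated by variables. -/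

section SpanX

variable {V K : Type*} [Field K]

theorem ker_killCompl (C : Set V) :
    RingHom.ker (killCompl (R := K) (f := ((↑) : {v // v ∉ C} → V)) Subtype.val_injective) =
      Ideal.span (X '' C) := by
  classical
  set κ := killCompl (R := K) (f := ((↑) : {v // v ∉ C} → V)) Subtype.val_injective with hκ
  have hX : ∀ v ∈ C, κ (X v) = 0 := by
    intro v hv
    simp [hκ, killCompl, hv]
  apply le_antisymm
  · intro f hf
    rw [RingHom.mem_ker] at hf
    have h : ∀ g, Ideal.Quotient.mkₐ K (Ideal.span (X '' C)) (rename (↑) (κ g)) =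
        Ideal.Quotient.mkₐ K (Ideal.span (X '' C)) g := by
      intro g
      have : ((Ideal.Quotient.mkₐ K (Ideal.span (X '' C : Set (MvPolynomial V K)))).comp
          (rename (↑))).comp κ = Ideal.Quotient.mkₐ K (Ideal.span (X '' C)) := by
        ext v
        simp only [AlgHom.comp_apply]
        by_cases hv : v ∈ C
        · rw [hX v hv, map_zero, map_zero, eq_comm]
          exact Ideal.Quotient.eq_zero_iff_mem.2 (Ideal.subset_span ⟨v, hv, rfl⟩)
        · have : κ (X v) = X ⟨v, hv⟩ := by
            have := killCompl_rename_app (R := K) (f := ((↑) : {v // v ∉ C} → V))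
              Subtype.val_injective (X ⟨v, hv⟩)
            rwa [rename_X] at this
          rw [this, rename_X]
      exact DFunLike.congr_fun this g
    have := h f
    rw [hf, map_zero, map_zero, eq_comm] at this
    exact Ideal.Quotient.eq_zero_iff_mem.1 this
  · rw [Ideal.span_le]
    rintro _ ⟨v, hv, rfl⟩
    exact hX v hv

theorem isPrime_span_X_image (C : Set V) :
    (Ideal.span (X '' C) : Ideal (MvPolynomial V K)).IsPrime := by
  rw [← ker_killCompl]
  exact RingHom.ker_isPrime _

theorem ringKrullDim_quotient_span_X_image [Finite V] (C : Set V) :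
    ringKrullDim (MvPolynomial V K ⧸ (Ideal.span (X '' C) : Ideal (MvPolynomial V K))) =
      Nat.card {v // v ∉ C} := by
  rw [← ker_killCompl]
  have hs : Function.Surjective (killCompl (R := K) (f := ((↑) : {v // v ∉ C} → V))
      Subtype.val_injective) := fun p => ⟨_, killCompl_rename_app Subtype.val_injective p⟩
  refine (ringKrullDim_eq_of_ringEquiv (Ideal.quotientKerAlgEquivOfSurjective hs).toRingEquiv).trans
    ?_
  rw [MvPolynomial.ringKrullDim_of_isNoetherianRing, ringKrullDim_eq_zero_of_field, zero_add]

end SpanX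

/-! ### Vertex covers bound depth and dimension. -/

namespace FacetComplex

variable {V K : Type*} [Field K]

theorem monomialOf_eq (S : Finset V) :
    monomialOf K S = monomial (Finsupp.indicator S fun _ _ => 1) 1 := by
  classical
  rw [monomialOf, monomial_eq, C_1, one_mul, Finsupp.prod_of_support_subset (s := S)]
  · refine Finset.prod_congr rfl fun v hv => ?_
    simp [hv]
  · intro v hv
    by_contra h
    simp [h] at hv
  · simp

theorem monomialOf_mem_span_X_image {S : Finset V} {C : Set V} :
    monomialOf K S ∈ (Ideal.span (X '' C) : Ideal (MvPolynomial V K)) ↔ ∃ v ∈ S, v ∈ C := by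
  classical
  rw [monomialOf_eq, mem_ideal_span_X_image]
  simp only [support_monomial, one_ne_zero, if_false, Finset.mem_singleton, forall_eq]
  constructor
  · rintro ⟨v, hv, h⟩
    refine ⟨v, ?_, hv⟩
    by_contra hS
    simp [hS] at h
  · rintro ⟨v, hv, h⟩
    exact ⟨v, h, by simp [hv]⟩

theorem monomialOf_mul_monomialOf [DecidableEq V] {S T : Finset V} (h : Disjoint S T) :
    monomialOf K S * monomialOf K T = monomialOf K (S ∪ T) :=
  (Finset.prod_union h).symm

theorem monomialOf_dvd {S T : Finset V} (h : S ⊆ T) : monomialOf K S ∣ monomialOf K T :=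
  Finset.prod_dvd_prod_of_subset _ _ _ h

theorem facetIdeal_le_span_X_image {D : PreAbstractSimplicialComplex V} {C : Set V} :
    facetIdeal K D ≤ Ideal.span (X '' C) ↔ ∀ H ∈ facets D, ∃ v ∈ H, v ∈ C := by
  rw [facetIdeal, Ideal.span_le]
  constructor
  · intro h H hH
    exact monomialOf_mem_span_X_image.1 (h ⟨H, hH, rfl⟩)
  · rintro h _ ⟨H, hH, rfl⟩
    exact monomialOf_mem_span_X_image.2 (h H hH)

theorem span_X_image_le_idealOfVars (C : Set V) :
    (Ideal.span (X '' C) : Ideal (MvPolynomial V K)) ≤ idealOfVars V K :=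
  Ideal.span_mono (Set.image_subset_range _ _)

theorem isPrime_idealOfVars : (idealOfVars V K).IsPrime := by
  rw [idealOfVars, ← Set.image_univ]
  exact isPrime_span_X_image _

/-- The quotient by the prime of a minimal vertex cover bounds the depth. -/
theorem depthQuotient_facetIdeal_le [Finite V] {D : PreAbstractSimplicialComplex V} {C : Set V}
    (hC : ∀ H ∈ facets D, ∃ v ∈ H, v ∈ C)
    (hmin : ∀ c ∈ C, ∃ H ∈ facets D, ∀ v ∈ H, v ∈ C → v = c) :
    depthQuotient (facetIdeal K D) ≤ Nat.card {v // v ∉ C} := by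
  classical
  have := Fintype.ofFinite V
  rw [depthQuotient]
  refine iSup₂_le fun rs hrs => ?_
  obtain ⟨hm, hreg⟩ := hrs
  rw [← ringKrullDim_quotient_span_X_image (K := K) C]
  have := isPrime_idealOfVars (V := V) (K := K)
  have hP := isPrime_span_X_image (K := K) C
  -- The monomial of the complement of C has the cover prime as its annihilator: by minimality,
  -- adding any c in C completes a facet.
  let T : Finset V := Finset.univ.filter (· ∉ C)
  refine length_le_ringKrullDim_quotient_of_isWeaklyRegular (m := idealOfVars V K) rs
    (MvPolynomial V K ⧸ facetIdeal K D) _ (Ideal.Quotient.mk _ (monomialOf K T)) ?_ ?_ hm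
    hreg.toIsWeaklyRegular
  · intro r hr
    rw [← Submodule.mem_annihilator_span_singleton]
    refine (Ideal.span_le.2 ?_ : Ideal.span (X '' C) ≤ _) hr
    rintro _ ⟨c, hc, rfl⟩
    rw [SetLike.mem_coe, Submodule.mem_annihilator_span_singleton]
    obtain ⟨H, hH, hHc⟩ := hmin c hc
    change Ideal.Quotient.mk _ (X c * monomialOf K T) = 0
    rw [Ideal.Quotient.eq_zero_iff_mem]
    have hXc : X c = monomialOf K {c} := by simp [monomialOf]
    rw [hXc, monomialOf_mul_monomialOf (by simp [T, hc])]
    refine Ideal.mem_of_dvd _ (monomialOf_dvd ?_) (Ideal.subset_span ⟨H, hH, rfl⟩)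
    intro v hv
    by_cases h : v ∈ C
    · simp [hHc v hv h]
    · simp [T, h]
  · intro r hr
    change Ideal.Quotient.mk _ (r * monomialOf K T) = 0 at hr
    rw [Ideal.Quotient.eq_zero_iff_mem] at hr
    refine span_X_image_le_idealOfVars C ((hP.mem_or_mem
      (facetIdeal_le_span_X_image.2 hC hr)).resolve_right fun h => ?_)
    obtain ⟨v, hv, h⟩ := monomialOf_mem_span_X_image.1 h
    simp only [T, Finset.mem_filter] at hv
    exact hv.2 h

theorem le_ringKrullDim_quotient_facetIdeal [Finite V] {D : PreAbstractSimplicialComplex V}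
    {C : Set V} (hC : ∀ H ∈ facets D, ∃ v ∈ H, v ∈ C) :
    (Nat.card {v // v ∉ C} : WithBot ℕ∞) ≤ ringKrullDim (MvPolynomial V K ⧸ facetIdeal K D) := by
  rw [← ringKrullDim_quotient_span_X_image (K := K) C]
  exact ringKrullDim_le_of_surjective _
    (Ideal.Quotient.factor_surjective (facetIdeal_le_span_X_image.2 hC))

/-- Cohen-Macaulay facet ideals are unmixed: minimal vertex covers have minimal size. -/
theorem IsCohenMacaulayQuotient.ncard_le [Finite V] {D : PreAbstractSimplicialComplex V}
    (h : IsCohenMacaulayQuotient (facetIdeal K D)) {C C' : Set V}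
    (hC : ∀ H ∈ facets D, ∃ v ∈ H, v ∈ C)
    (hmin : ∀ c ∈ C, ∃ H ∈ facets D, ∀ v ∈ H, v ∈ C → v = c)
    (hC' : ∀ H ∈ facets D, ∃ v ∈ H, v ∈ C') : C.ncard ≤ C'.ncard := by
  have h1 := (le_ringKrullDim_quotient_facetIdeal (K := K) hC').trans
    ((le_of_eq h.symm).trans (depthQuotient_facetIdeal_le hC hmin))
  have h2 : Nat.card {v // v ∉ C'} ≤ Nat.card {v // v ∉ C} := by exact_mod_cast h1
  have e : ∀ C : Set V, C.ncard + Nat.card {v // v ∉ C} = Nat.card V := fun C =>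
    Set.ncard_add_ncard_compl C
  have := e C
  have := e C'
  omega

/-- A prime over the facet ideal contains a variable from each member of L; disjointness makes these
|L| variables distinct. -/
theorem ringKrullDim_quotient_facetIdeal_le [Finite V] {D : PreAbstractSimplicialComplex V}
    {L : Finset (Finset V)} (hL : (L : Set (Finset V)) ⊆ facets D)
    (hd : (L : Set (Finset V)).PairwiseDisjoint id) :
    ringKrullDim (MvPolynomial V K ⧸ facetIdeal K D) ≤ (Nat.card V - L.card : ℕ) := by
  classical
  refine ringKrullDim_quotient_le_of_forall_prime fun Q hQ hIQ => ?_
  have hex : ∀ H ∈ L, ∃ v ∈ H, (X v : MvPolynomial V K) ∈ Q := fun H hH =>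
    (hQ.prod_mem_iff).1 (hIQ (Ideal.subset_span ⟨H, hL hH, rfl⟩))
  choose g hg hgQ using hex
  let C : Finset V := L.attach.image fun H => g H.1 H.2
  refine ⟨Ideal.span (X '' (C : Set V)), ?_, ?_⟩
  · rw [Ideal.span_le]
    rintro _ ⟨v, hv, rfl⟩
    obtain ⟨H, -, rfl⟩ := Finset.mem_image.1 hv
    exact hgQ H.1 H.2
  · rw [ringKrullDim_quotient_span_X_image]
    have hinj : C.card = L.card := by
      rw [Finset.card_image_of_injective, Finset.card_attach]
      rintro ⟨A, hA⟩ ⟨B, hB⟩ hAB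
      by_contra hne
      refine Finset.disjoint_left.1 (hd hA hB fun h => hne (Subtype.ext h)) (hg A hA) ?_
      exact (show g A hA = g B hB from hAB) ▸ hg B hB
    have := Set.ncard_add_ncard_compl (C : Set V)
    rw [Set.ncard_coe_finset, hinj] at this
    have e : Nat.card {v // v ∉ (C : Set V)} = Nat.card V - L.card := by
      change (C : Set V)ᶜ.ncard = _
      omega
    rw [e]

end FacetComplex

/-! ### Combinatorics of families with leaves. -/

/-- Every nonempty subfamily has a leaf. -/
def HasLeaves {V : Type*} [DecidableEq V] (S : Finset (Finset V)) : Prop :=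
  ∀ T ⊆ S, T.Nonempty → ∃ F ∈ T, (∀ H ∈ T, H = F) ∨
    ∃ G ∈ T, G ≠ F ∧ ∀ H ∈ T, H ≠ F → F ∩ H ⊆ G

/-- `L` consists of pairwise disjoint members of `S` that cover all members of `S`, and the members
of `S` cut out a chain in each member of `L`. -/
structure IsGrafting {V : Type*} [DecidableEq V] (S L : Finset (Finset V)) : Prop where
  subset : L ⊆ S
  disjoint : (L : Set (Finset V)).PairwiseDisjoint id
  cover : ∀ H ∈ S, ∀ v ∈ H, ∃ F ∈ L, v ∈ F
  chain : ∀ F ∈ L, ∀ H₁ ∈ S, ∀ H₂ ∈ S, F ∩ H₁ ⊆ H₂ ∨ F ∩ H₂ ⊆ H₁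

namespace HasLeaves

variable {V : Type*} [DecidableEq V] {S : Finset (Finset V)}

theorem mono {T : Finset (Finset V)} (h : HasLeaves S) (hT : T ⊆ S) : HasLeaves T :=
  fun U hU hne => h U (hU.trans hT) hne

/-- König's theorem for simplicial forests. -/
theorem exists_matching_cover (h : HasLeaves S) (hne : ∀ H ∈ S, H.Nonempty) :
    ∃ M ⊆ S, (M : Set (Finset V)).PairwiseDisjoint id ∧
      ∃ C : Finset V, (∀ H ∈ S, ∃ v ∈ H, v ∈ C) ∧ C.card ≤ M.card := by
  induction S using Finset.strongInduction with
  | H S ih =>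
  rcases S.eq_empty_or_nonempty with rfl | hS
  · exact ⟨∅, subset_rfl, by simp, ∅, by simp, by simp⟩
  obtain ⟨F, hF, hleaf⟩ := h S subset_rfl hS
  have isolated : (∀ H ∈ S, H ≠ F → Disjoint F H) → ∃ M ⊆ S,
      (M : Set (Finset V)).PairwiseDisjoint id ∧
      ∃ C : Finset V, (∀ H ∈ S, ∃ v ∈ H, v ∈ C) ∧ C.card ≤ M.card := by
    intro hd
    obtain ⟨M, hM, hMd, C, hC, hcard⟩ := ih (S.erase F) (Finset.erase_ssubset hF)
      (h.mono (Finset.erase_subset _ _)) (fun H hH => hne H (Finset.mem_of_mem_erase hH))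
    obtain ⟨v, hv⟩ := hne F hF
    have hFM : F ∉ M := fun hh => Finset.notMem_erase F S (hM hh)
    refine ⟨insert F M, ?_, ?_, insert v C, ?_, ?_⟩
    · exact Finset.insert_subset hF (hM.trans (Finset.erase_subset _ _))
    · rw [Finset.coe_insert, Set.pairwiseDisjoint_insert_of_notMem (by simpa using hFM)]
      exact ⟨hMd, fun H hH => hd H (Finset.mem_of_mem_erase (hM hH))
        (Finset.ne_of_mem_erase (hM hH))⟩
    · intro H hH
      by_cases hHF : H = F
      · exact ⟨v, hHF ▸ hv, by simp⟩
      · obtain ⟨w, hw, hwC⟩ := hC H (Finset.mem_erase.2 ⟨hHF, hH⟩)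
        exact ⟨w, hw, Finset.mem_insert_of_mem hwC⟩
    · rw [Finset.card_insert_of_notMem hFM]
      exact (Finset.card_insert_le _ _).trans (by omega)
  rcases hleaf with honly | ⟨G, hG, hGF, hjoint⟩
  · exact isolated fun H hH hHF => absurd (honly H hH) hHF
  by_cases hFG : Disjoint F G
  · refine isolated fun H hH hHF => ?_
    rw [Finset.disjoint_left] at hFG ⊢
    exact fun v hv hvH => hFG hv (hjoint H hH hHF (Finset.mem_inter.2 ⟨hv, hvH⟩))
  obtain ⟨w, hwF, hwG⟩ := Finset.not_disjoint_iff.1 hFG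
  obtain ⟨M, hM, hMd, C, hC, hcard⟩ := ih (S.erase G) (Finset.erase_ssubset hG)
    (h.mono (Finset.erase_subset _ _)) (fun H hH => hne H (Finset.mem_of_mem_erase hH))
  refine ⟨M, hM.trans (Finset.erase_subset _ _), hMd, ?_⟩
  obtain ⟨v, hvF, hvC⟩ := hC F (Finset.mem_erase.2 ⟨hGF.symm, hF⟩)
  by_cases hvG : v ∈ G
  · refine ⟨C, fun H hH => ?_, hcard⟩
    by_cases hHG : H = G
    · exact ⟨v, hHG ▸ hvG, hvC⟩
    · exact hC H (Finset.mem_erase.2 ⟨hHG, hH⟩)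
  -- Since v is outside the joint G, among the members of S only F contains it. Exchanging v for w
  -- in F ∩ G therefore still covers everything and now covers G too.
  · refine ⟨insert w (C.erase v), fun H hH => ?_, ?_⟩
    · by_cases hHG : H = G
      · exact ⟨w, hHG ▸ hwG, by simp⟩
      by_cases hHF : H = F
      · exact ⟨w, hHF ▸ hwF, by simp⟩
      obtain ⟨u, hu, huC⟩ := hC H (Finset.mem_erase.2 ⟨hHG, hH⟩)
      refine ⟨u, hu, Finset.mem_insert_of_mem (Finset.mem_erase.2 ⟨?_, huC⟩)⟩
      rintro rfl
      exact hvG (hjoint H hH hHF (Finset.mem_inter.2 ⟨hvF, hu⟩))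
    · have := Finset.card_insert_le w (C.erase v)
      rw [Finset.card_erase_of_mem hvC] at this
      have := Finset.card_pos.2 ⟨v, hvC⟩
      omega

/-- A joint of F would have to contain both x and y. -/
theorem not_isLeaf_of_two_neighbors {T : Finset (Finset V)} {F A B : Finset V} {x y : V}
    (hA : A ∈ T) (hB : B ∈ T) (hAF : A ≠ F) (hBF : B ≠ F) (hxF : x ∈ F) (hxA : x ∈ A)
    (hyF : y ∈ F) (hyB : y ∈ B) (hT : ∀ G ∈ T, G ≠ F → x ∉ G ∨ y ∉ G) :
    ¬ ((∀ H ∈ T, H = F) ∨ ∃ G ∈ T, G ≠ F ∧ ∀ H ∈ T, H ≠ F → F ∩ H ⊆ G) := by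
  rintro (h | ⟨G, hG, hGF, h⟩)
  · exact hAF (h A hA)
  · rcases hT G hG hGF with hh | hh
    · exact hh (h A hA hAF (Finset.mem_inter.2 ⟨hxF, hxA⟩))
    · exact hh (h B hB hBF (Finset.mem_inter.2 ⟨hyF, hyB⟩))

/-- Any two of the sets share a vertex that the third lacks, so none is a leaf of the triple. -/
theorem no_triangle (h : HasLeaves S) {A B C : Finset V} (hA : A ∈ S) (hB : B ∈ S) (hC : C ∈ S)
    {x y z : V} (hxA : x ∈ A) (hxB : x ∈ B) (hxC : x ∉ C) (hyA : y ∈ A) (hyB : y ∉ B) (hyC : y ∈ C)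
    (hzA : z ∉ A) (hzB : z ∈ B) (hzC : z ∈ C) : False := by
  obtain ⟨F, hF, hl⟩ := h {A, B, C} (by simp [Finset.insert_subset_iff, hA, hB, hC]) (by simp)
  have hAB : A ≠ B := fun e => hyB (e ▸ hyA)
  have hAC : A ≠ C := fun e => hxC (e ▸ hxA)
  have hBC : B ≠ C := fun e => hxC (e ▸ hxB)
  simp only [Finset.mem_insert, Finset.mem_singleton] at hF
  rcases hF with rfl | rfl | rfl
  · exact not_isLeaf_of_two_neighbors (A := B) (B := C) (by simp) (by simp) hAB.symm hAC.symm
      hxA hxB hyA hyC (by simp [hxC, hyB]) hl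
  · exact not_isLeaf_of_two_neighbors (A := A) (B := C) (by simp) (by simp) hAB hBC.symm
      hxB hxA hzB hzC (by simp [hxC, hzA]) hl
  · exact not_isLeaf_of_two_neighbors (A := A) (B := B) (by simp) (by simp) hAC hBC
      hyC hyA hzC hzB (by simp [hyB, hzA]) hl

/-- No member of {F, A, B, C} can be a leaf. F needs a joint containing a and b. A joint of A
contains a, hence is F, which produces a triangle F, B, C; B is symmetric. A joint of C contains C ∩
A and C ∩ B, hence all of C, against the antichain condition. -/
theorem no_quadrangle (h : HasLeaves S) (hanti : ∀ A ∈ S, ∀ B ∈ S, A ⊆ B → A = B)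
    {F A B C : Finset V} (hF : F ∈ S) (hA : A ∈ S) (hB : B ∈ S) (hC : C ∈ S) {a b : V}
    (haF : a ∈ F) (haA : a ∈ A) (haB : a ∉ B) (haC : a ∉ C)
    (hbF : b ∈ F) (hbA : b ∉ A) (hbB : b ∈ B) (hbC : b ∉ C) (hsub : C ⊆ A ∪ B) : False := by
  have diff : ∀ X ∈ S, C ≠ X → ∃ v ∈ C, v ∉ X := fun X hX hne =>
    Finset.not_subset.1 fun hs => hne (hanti C hC X hX hs)
  have hCF : C ≠ F := by rintro rfl; exact haC haF
  have hCA : C ≠ A := by rintro rfl; exact haC haA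
  have hCB : C ≠ B := by rintro rfl; exact hbC hbB
  obtain ⟨e, heC, heF⟩ := diff F hF hCF
  obtain ⟨d, hdC, hdB⟩ := diff B hB hCB
  obtain ⟨c, hcC, hcA⟩ := diff A hA hCA
  have hor : ∀ v ∈ C, v ∈ A ∨ v ∈ B := fun v hv => Finset.mem_union.1 (hsub hv)
  obtain ⟨X, hX, hl⟩ := h {F, A, B, C} (by simp [Finset.insert_subset_iff, hF, hA, hB, hC])
    (by simp)
  have hXF : X ≠ F := by
    rintro rfl
    have hAX : A ≠ X := fun e => hbA (e ▸ hbF)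
    have hBX : B ≠ X := fun e => haB (e ▸ haF)
    exact not_isLeaf_of_two_neighbors (A := A) (B := B) (by simp) (by simp) hAX hBX haF haA hbF hbB
      (by simp [hbA, haB, haC]) hl
  rcases hl with hl | ⟨G, hG, hGX, hl⟩
  · exact hCF ((hl C (by simp)).trans (hl F (by simp)).symm)
  have hjoint : ∀ H ∈ ({F, A, B, C} : Finset (Finset V)), H ≠ X → ∀ v ∈ X, v ∈ H → v ∈ G :=
    fun H hH hHX v hv hvH => hl H hH hHX (Finset.mem_inter.2 ⟨hv, hvH⟩)
  simp only [Finset.mem_insert, Finset.mem_singleton] at hX hG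
  rcases hX with rfl | rfl | rfl | rfl
  · exact hXF rfl
  · have haG : a ∈ G := hjoint F (by simp) hXF.symm a haA haF
    obtain rfl : G = F := by
      rcases hG with e | e | rfl | rfl
      · exact e
      · exact absurd e hGX
      · exact absurd haG haB
      · exact absurd haG haC
    have key : ∀ v ∈ X, v ∈ C → v ∈ G := hjoint C (by simp) hCA
    exact h.no_triangle hF hB hC (x := b) (y := d) (z := e) hbF hbB hbC
      (key d ((hor d hdC).resolve_right hdB) hdC) hdB hdC
      heF ((hor e heC).resolve_left fun hh => heF (key e hh heC)) heC
  · have hbG : b ∈ G := hjoint F (by simp) hXF.symm b hbB hbF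
    obtain rfl : G = F := by
      rcases hG with e | rfl | e | rfl
      · exact e
      · exact absurd hbG hbA
      · exact absurd e hGX
      · exact absurd hbG hbC
    have key : ∀ v ∈ X, v ∈ C → v ∈ G := hjoint C (by simp) hCB
    exact h.no_triangle hF hA hC (x := a) (y := c) (z := e) haF haA haC
      (key c ((hor c hcC).resolve_left hcA) hcC) hcA hcC
      heF ((hor e heC).resolve_right fun hh => heF (key e hh heC)) heC
  · have hGS : G ∈ S := by rcases hG with rfl | rfl | rfl | rfl <;> assumption
    refine hGX (hanti X hC G hGS fun v hv => ?_).symm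
    rcases hor v hv with hvA | hvB
    · exact hjoint A (by simp) hCA.symm v hv hvA
    · exact hjoint B (by simp) hCB.symm v hv hvB

end HasLeaves

/-! ### Minimal covers, and unmixed forests are grafted. -/

section Covers

variable {V : Type*} [DecidableEq V] {S : Finset (Finset V)}

/-- The complement of T is a cover; shrink it to a minimal one. -/
theorem exists_minimal_cover_disjoint [Fintype V] {T : Finset V} (hT : ∀ H ∈ S, ¬ H ⊆ T) :
    ∃ C : Finset V, (∀ H ∈ S, ∃ v ∈ H, v ∈ C) ∧
      (∀ c ∈ C, ∃ H ∈ S, ∀ v ∈ H, v ∈ C → v = c) ∧ Disjoint C T := by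
  obtain ⟨C, hCT, hC⟩ := exists_minimal_le_of_wellFoundedLT
    (fun C : Finset V => ∀ H ∈ S, ∃ v ∈ H, v ∈ C) Tᶜ (fun H hH => by
      obtain ⟨v, hv, hvT⟩ := Finset.not_subset.1 (hT H hH)
      exact ⟨v, hv, by simpa using hvT⟩)
  refine ⟨C, hC.1, fun c hc => ?_, ?_⟩
  · by_contra! hcon
    have := hC.2 (y := C.erase c) (fun H hH => by
      obtain ⟨v, hv, hvC, hvc⟩ := hcon H hH
      exact ⟨v, hv, Finset.mem_erase.2 ⟨hvc, hvC⟩⟩) (Finset.erase_subset _ _) hc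
    exact Finset.notMem_erase c C this
  · exact Finset.disjoint_left.2 fun v hv hvT => Finset.mem_compl.1 (hCT hv) hvT

/-- Each member of M uses up its own element of C, and the cardinality leaves none over. -/
theorem transversal_of_card_le {M : Finset (Finset V)} {C : Finset V}
    (hM : (M : Set (Finset V)).PairwiseDisjoint id) (hC : ∀ H ∈ M, ∃ v ∈ H, v ∈ C)
    (hcard : C.card ≤ M.card) :
    (∀ c ∈ C, ∃ F ∈ M, c ∈ F) ∧ ∀ F ∈ M, ∀ a ∈ F, ∀ b ∈ F, a ∈ C → b ∈ C → a = b := by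
  choose g hg hgC using hC
  have huniq : ∀ A ∈ M, ∀ B ∈ M, ∀ v ∈ A, v ∈ B → A = B := fun A hA B hB v hvA hvB =>
    hM.elim hA hB (Finset.not_disjoint_iff.2 ⟨v, hvA, hvB⟩)
  have himg : (M.attach.image fun H => g H.1 H.2) = C := by
    refine Finset.eq_of_subset_of_card_le (Finset.image_subset_iff.2 fun H _ => hgC H.1 H.2) ?_
    rwa [Finset.card_image_of_injective, Finset.card_attach]
    rintro ⟨A, hA⟩ ⟨B, hB⟩ hAB
    exact Subtype.ext (huniq A hA B hB _ (hg A hA)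
      ((show g A hA = g B hB from hAB) ▸ hg B hB))
  have hsurj : ∀ F (hF : F ∈ M), ∀ a ∈ F, a ∈ C → a = g F hF := by
    intro F hF a ha haC
    obtain ⟨⟨A, hA⟩, -, rfl⟩ := Finset.mem_image.1 (himg ▸ haC)
    obtain rfl := huniq A hA F hF _ (hg A hA) ha
    rfl
  refine ⟨fun c hc => ?_, fun F hF a ha b hb haC hbC =>
    (hsurj F hF a ha haC).trans (hsurj F hF b hb hbC).symm⟩
  obtain ⟨⟨A, hA⟩, -, rfl⟩ := Finset.mem_image.1 (himg ▸ hc)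
  exact ⟨A, hA, hg A hA⟩

/-- Unmixed simplicial forests are grafted. -/
theorem HasLeaves.exists_isGrafting [Fintype V] (h : HasLeaves S) (hne : ∀ H ∈ S, H.Nonempty)
    (hanti : ∀ A ∈ S, ∀ B ∈ S, A ⊆ B → A = B)
    (hunm : ∀ C C' : Finset V, (∀ H ∈ S, ∃ v ∈ H, v ∈ C) →
      (∀ c ∈ C, ∃ H ∈ S, ∀ v ∈ H, v ∈ C → v = c) → (∀ H ∈ S, ∃ v ∈ H, v ∈ C') →
      C.card ≤ C'.card) :
    ∃ L, IsGrafting S L := by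
  obtain ⟨M, hMS, hMd, C₀, hC₀, hcard⟩ := h.exists_matching_cover hne
  have trans : ∀ C : Finset V, (∀ H ∈ S, ∃ v ∈ H, v ∈ C) →
      (∀ c ∈ C, ∃ H ∈ S, ∀ v ∈ H, v ∈ C → v = c) → _ := fun C hC hmin =>
    transversal_of_card_le hMd (fun H hH => hC H (hMS hH)) ((hunm C C₀ hC hmin hC₀).trans hcard)
  refine ⟨M, hMS, hMd, fun H hH v hv => ?_, fun F hF A hA B hB => ?_⟩
  -- A minimal cover avoiding the rest of H must contain v, so v lies in a member of M.
  · obtain ⟨C, hC, hmin, hd⟩ := exists_minimal_cover_disjoint (S := S) (T := H.erase v) (by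
      intro A hA hAH
      have := hanti A hA H hH (hAH.trans (Finset.erase_subset _ _))
      exact Finset.notMem_erase v H (hAH (this ▸ hv)))
    obtain ⟨w, hw, hwC⟩ := hC H hH
    have hwv : w = v := by
      by_contra hne
      exact Finset.disjoint_left.1 hd hwC (Finset.mem_erase.2 ⟨hne, hw⟩)
    exact (trans C hC hmin).1 v (hwv ▸ hwC)
  · by_contra! hcon
    obtain ⟨a, ha, haB⟩ := Finset.not_subset.1 hcon.1
    obtain ⟨b, hb, hbA⟩ := Finset.not_subset.1 hcon.2
    rw [Finset.mem_inter] at ha hb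
    -- A minimal cover avoiding A ∪ B except for a and b can meet A only in a and B only in b, so it
    -- has two vertices in F. `no_quadrangle` rules out a member inside the avoided set.
    obtain ⟨C, hC, hmin, hd⟩ := exists_minimal_cover_disjoint (S := S)
      (T := ((A ∪ B).erase a).erase b) (by
        intro E hE hEs
        refine h.no_quadrangle hanti (hMS hF) hA hB hE ha.1 ha.2 haB (fun hh => ?_) hb.1 hbA hb.2
          (fun hh => ?_)
          (hEs.trans ((Finset.erase_subset _ _).trans (Finset.erase_subset _ _)))
        · have := hEs hh
          simp at this
        · have := hEs hh
          simp at this)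
    have hmem : ∀ w ∈ C, w ∈ A ∪ B → w = a ∨ w = b := by
      intro w hw hwAB
      by_contra! hne
      exact Finset.disjoint_left.1 hd hw
        (Finset.mem_erase.2 ⟨hne.2, Finset.mem_erase.2 ⟨hne.1, hwAB⟩⟩)
    have haC : a ∈ C := by
      obtain ⟨w, hw, hwC⟩ := hC A hA
      rcases hmem w hwC (Finset.mem_union_left _ hw) with rfl | rfl
      · exact hwC
      · exact absurd hw hbA
    have hbC : b ∈ C := by
      obtain ⟨w, hw, hwC⟩ := hC B hB
      rcases hmem w hwC (Finset.mem_union_right _ hw) with rfl | rfl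
      · exact absurd hw haB
      · exact hwC
    have := (trans C hC hmin).2 F hF a ha.1 b hb.1 haC hbC
    exact hbA (this ▸ ha.2)

end Covers

/-! ### Non-zero-divisors modulo monomial ideals. -/

section NonZeroDivisors

variable {σ K : Type*} [Field K]

/-- Among the exponents of g outside the ideal take u with the largest b-entry. If u + b is outside
the ideal, cancellation forces u + b - a into the support, against maximality. Otherwise a generator
containing b gives u b = 0 and t ≤ u a; then u + a is still outside the ideal and its coefficient in
the product is, up to sign, that of u. -/
theorem mem_of_X_sub_X_mul_mem {S : Set (σ →₀ ℕ)} {a b : σ} (hab : a ≠ b) (t : ℕ)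
    (hb : ∀ m ∈ S, m b ≤ 1) (ha : ∀ m ∈ S, m a ≤ t) (hba : ∀ m ∈ S, m b ≠ 0 → t ≤ m a)
    {g : MvPolynomial σ K}
    (hg : (X b - X a) * g ∈ Ideal.span ((fun s => monomial s (1 : K)) '' S)) :
    g ∈ Ideal.span ((fun s => monomial s (1 : K)) '' S) := by
  classical
  rw [mem_ideal_span_monomial_image] at hg ⊢
  by_contra! hcon
  obtain ⟨u₀, hu₀, hu₀S⟩ := hcon
  let B := g.support.filter fun u => ∀ s ∈ S, ¬ s ≤ u
  obtain ⟨u, hu, hmax⟩ := B.exists_max_image (fun u => u b)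
    ⟨u₀, Finset.mem_filter.2 ⟨hu₀, hu₀S⟩⟩
  obtain ⟨hug, huS⟩ := Finset.mem_filter.1 hu
  rw [mem_support_iff] at hug
  have hcoeff : ∀ n : σ →₀ ℕ, (∀ s ∈ S, ¬ s ≤ n) → coeff n ((X b - X a) * g) = 0 := by
    intro n hn
    by_contra h
    obtain ⟨s, hs, hsn⟩ := hg n (mem_support_iff.2 h)
    exact hn s hs hsn
  obtain ⟨s, hs, hsu⟩ : ∃ s ∈ S, s ≤ u + Finsupp.single b 1 := by
    by_contra! hno
    have h := hcoeff _ hno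
    rw [sub_mul, coeff_sub, coeff_X_mul', coeff_X_mul'] at h
    rw [if_pos (by simp), add_tsub_cancel_right] at h
    split_ifs at h with hmem
    · have hua : u a ≠ 0 := by simpa [Finsupp.single_apply, hab.symm] using hmem
      have hw : u + Finsupp.single b 1 - Finsupp.single a 1 ∈ B := by
        refine Finset.mem_filter.2 ⟨mem_support_iff.2 ?_, fun s hs hsw => ?_⟩
        · rwa [← sub_eq_zero.1 h]
        · exact hno s hs (hsw.trans tsub_le_self)
      have := hmax _ hw
      simp [hab.symm] at this
    · exact hug (by simpa using h)
  have hle : ∀ x, x ≠ b → s x ≤ u x := fun x hx => by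
    simpa [Finsupp.single_apply, hx.symm] using hsu x
  have hsb : s b = u b + 1 := by
    refine le_antisymm (by simpa using hsu b) ?_
    by_contra! hlt
    refine huS s hs fun x => ?_
    by_cases hx : x = b
    · subst hx; omega
    · exact hle x hx
  have hub : u b = 0 := by have := hb s hs; omega
  have hta : t ≤ u a := (hba s hs (by omega)).trans (hle a hab)
  have hno : ∀ s ∈ S, ¬ s ≤ u + Finsupp.single a 1 := by
    intro s hs hsu
    refine huS s hs fun x => ?_
    by_cases hx : x = a
    · subst hx; exact (ha s hs).trans hta
    · simpa [Finsupp.single_apply, Ne.symm hx] using hsu x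
  have h := hcoeff _ hno
  rw [sub_mul, coeff_sub, coeff_X_mul', coeff_X_mul'] at h
  rw [if_neg (by simp [hub, hab]), if_pos (by simp), add_tsub_cancel_right] at h
  exact hug (by simpa using h)

theorem mem_of_X_mul_mem {S : Set (σ →₀ ℕ)} {b : σ} (hb : ∀ m ∈ S, m b = 0)
    {g : MvPolynomial σ K} (hg : X b * g ∈ Ideal.span ((fun s => monomial s (1 : K)) '' S)) :
    g ∈ Ideal.span ((fun s => monomial s (1 : K)) '' S) := by
  classical
  rw [mem_ideal_span_monomial_image] at hg ⊢
  intro u hu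
  obtain ⟨s, hs, hsu⟩ := hg (Finsupp.single b 1 + u) (by
    rw [mem_support_iff, coeff_X_mul]
    exact mem_support_iff.1 hu)
  refine ⟨s, hs, fun x => ?_⟩
  by_cases hx : x = b
  · subst hx; simp [hb s hs]
  · simpa [Finsupp.single_apply, Ne.symm hx] using hsu x

/-- Regularity modulo a substitution: if `φ` substitutes `c v` for `X v`, then a product lies in
`I` plus the ideal of the substitution as soon as its image lies in the image of `I`. -/
theorem mem_sup_of_mul_mem_sup {B : Set σ} {c : σ → MvPolynomial σ K}
    (φ : MvPolynomial σ K →ₐ[K] MvPolynomial σ K) (hφB : ∀ v ∈ B, φ (X v) = c v)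
    (hφ : ∀ v, v ∉ B → φ (X v) = X v) (hc : ∀ v ∈ B, φ (c v) = c v)
    {I : Ideal (MvPolynomial σ K)} {θ : MvPolynomial σ K}
    (hθ : ∀ g, φ θ * g ∈ I.map φ → g ∈ I.map φ) {f : MvPolynomial σ K}
    (hf : θ * f ∈ Ideal.span ((fun v => X v - c v) '' B) ⊔ I) :
    f ∈ Ideal.span ((fun v => X v - c v) '' B) ⊔ I := by
  set E : Ideal (MvPolynomial σ K) := Ideal.span ((fun v => X v - c v) '' B) with hE
  have hsub : ∀ g, g - φ g ∈ E := by
    intro g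
    have : (Ideal.Quotient.mkₐ K E).comp φ = Ideal.Quotient.mkₐ K E := by
      ext v
      by_cases hv : v ∈ B
      · rw [AlgHom.comp_apply, hφB v hv]
        exact (Ideal.Quotient.eq.2
          (show X v - c v ∈ E from Ideal.subset_span ⟨v, hv, rfl⟩)).symm
      · rw [AlgHom.comp_apply, hφ v hv]
    exact Ideal.Quotient.eq.1 (DFunLike.congr_fun this g).symm
  have hmap : E ⊔ I ≤ (I.map φ).comap φ := by
    refine sup_le ?_ Ideal.le_comap_map
    rw [hE, Ideal.span_le]
    rintro _ ⟨v, hv, rfl⟩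
    simp [hφB v hv, hc v hv]
  have hle : I.map φ ≤ E ⊔ I := by
    rw [Ideal.map_le_iff_le_comap]
    intro g hg
    have := Ideal.sub_mem _ (Ideal.mem_sup_right (S := E) hg) (Ideal.mem_sup_left (hsub g))
    rwa [sub_sub_cancel] at this
  have h := hmap hf
  rw [Ideal.mem_comap, map_mul] at h
  have := Ideal.add_mem _ (Ideal.mem_sup_left (T := I) (hsub f)) (hle (hθ _ h))
  rwa [sub_add_cancel] at this

end NonZeroDivisors

theorem mk_mem_smul_top_iff {R : Type*} [CommRing R] {I J : Ideal R} {f : R} :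
    (Ideal.Quotient.mk I f : R ⧸ I) ∈ (J • ⊤ : Submodule R (R ⧸ I)) ↔ f ∈ J ⊔ I := by
  rw [Ideal.smul_top_eq_map, Submodule.restrictScalars_mem]
  exact Ideal.mem_quotient_iff_mem_sup

theorem isRegular_quotient_of_forall {R : Type*} [CommRing R] {I : Ideal R} {rs : List R}
    (htop : Ideal.ofList rs ⊔ I ≠ ⊤)
    (h : ∀ i (hi : i < rs.length) (f : R), rs[i] * f ∈ Ideal.ofList (rs.take i) ⊔ I →
      f ∈ Ideal.ofList (rs.take i) ⊔ I) :
    RingTheory.Sequence.IsRegular (R ⧸ I) rs := by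
  refine ⟨⟨fun i hi => ?_⟩, fun htop' => ?_⟩
  · rw [isSMulRegular_quotient_iff_mem_of_smul_mem]
    intro x hx
    obtain ⟨f, rfl⟩ := Ideal.Quotient.mk_surjective x
    exact mk_mem_smul_top_iff.2 (h i hi f (mk_mem_smul_top_iff.1 hx))
  · have : (Ideal.Quotient.mk I 1 : R ⧸ I) ∈ (Ideal.ofList rs • ⊤ : Submodule R (R ⧸ I)) := by
      rw [← htop']; trivial
    exact htop ((Ideal.eq_top_iff_one _).2 (mk_mem_smul_top_iff.1 this))

theorem exists_sorted_list {V : Type*} (A : Finset V) (d : V → ℕ) :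
    ∃ l : List V, l.Nodup ∧ (∀ v, v ∈ l ↔ v ∈ A) ∧ l.length = A.card ∧
      l.Pairwise fun v w => d w ≤ d v := by
  classical
  have : Std.Total fun v w => d w ≤ d v := ⟨fun v w => le_total _ _⟩
  have : IsTrans V fun v w => d w ≤ d v := ⟨fun u v w h h' => le_trans h' h⟩
  have hp := List.perm_insertionSort (fun v w => d w ≤ d v) A.toList
  exact ⟨_, hp.nodup_iff.2 A.nodup_toList, fun v => by rw [hp.mem_iff, Finset.mem_toList],
    by rw [hp.length_eq, Finset.length_toList], List.pairwise_insertionSort _ _⟩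

/-! ### Grafted complexes are Cohen–Macaulay. -/

namespace FacetComplex

variable {V K : Type*} [Field K]

/-- The regular sequence that identifies the variables of each block with the root of the block and
kills the variables outside of `U`. -/
theorem exists_isRegular [DecidableEq V] [Fintype V] {D : PreAbstractSimplicialComplex V}
    (U : Finset V) (ρ : V → V) (d : V → ℕ) (hρU : ∀ v ∈ U, ρ v ∈ U) (hρ : ∀ v ∈ U, ρ (ρ v) = ρ v)
    (hHU : ∀ H ∈ facets D, H ⊆ U) (hdρ : ∀ v ∈ U, d v ≤ d (ρ v))
    (hd : ∀ v ∈ U, ∀ w ∈ U, ρ v = ρ w → d w ≤ d v → ∀ H ∈ facets D, w ∈ H → v ∈ H) :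
    ∃ rs : List (MvPolynomial V K), (∀ r ∈ rs, r ∈ idealOfVars V K) ∧
      RingTheory.Sequence.IsRegular (MvPolynomial V K ⧸ facetIdeal K D) rs ∧
      rs.length = (Finset.univ.filter fun v => ¬ (v ∈ U ∧ ρ v = v)).card := by
  -- Decreasing `d` ensures that block members merged before b lie in every facet containing b.
  obtain ⟨l, hnd, hmem, hlen, hsort⟩ :=
    exists_sorted_list (Finset.univ.filter fun v => ¬ (v ∈ U ∧ ρ v = v)) d
  simp only [Finset.mem_filter, Finset.mem_univ, true_and] at hmem
  let c : V → MvPolynomial V K := fun v => if v ∈ U then X (ρ v) else 0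
  have hX : ∀ v, (X v : MvPolynomial V K) ∈ idealOfVars V K :=
    fun v => Ideal.subset_span ⟨v, rfl⟩
  have hvars : ∀ v, X v - c v ∈ idealOfVars V K := by
    intro v
    refine Ideal.sub_mem _ (hX v) ?_
    by_cases hv : v ∈ U
    · simp only [c, if_pos hv]; exact hX _
    · simp [c, hv]
  refine ⟨l.map fun v => X v - c v, ?_, isRegular_quotient_of_forall ?_ ?_, ?_⟩
  · intro r hr
    obtain ⟨v, -, rfl⟩ := List.mem_map.1 hr
    exact hvars v
  · refine ne_top_of_le_ne_top isPrime_idealOfVars.ne_top (sup_le ?_ ?_ :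
      _ ≤ idealOfVars V K)
    · refine Ideal.span_le.2 fun r hr => ?_
      obtain ⟨v, -, rfl⟩ := List.mem_map.1 hr
      exact hvars v
    · rw [idealOfVars, ← Set.image_univ, facetIdeal_le_span_X_image]
      intro H hH
      obtain ⟨v, hv⟩ := (D.isRelLowerSet_faces hH.1).1
      exact ⟨v, hv, trivial⟩
  · intro i hi f hf
    rw [List.length_map] at hi
    let B : Set V := {v | v ∈ l.take i}
    have hspan : Ideal.ofList ((l.map fun v => X v - c v).take i) =
        Ideal.span ((fun v => X v - c v) '' B) := by
      rw [Ideal.ofList, ← List.map_take]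
      congr 1
      ext r
      rw [Set.mem_ofPred_eq, List.mem_map]
      rfl
    rw [hspan] at hf ⊢
    rw [List.getElem_map] at hf
    set b := l[i] with hb
    have hbl : b ∈ l := List.getElem_mem hi
    have hBl : ∀ v ∈ B, v ∈ l := fun v hv => List.mem_of_mem_take hv
    have hbB : b ∉ B := by
      intro hh
      obtain ⟨j, hj, hjb⟩ := List.mem_iff_getElem.1 hh
      rw [List.getElem_take] at hjb
      rw [List.length_take] at hj
      have := (hnd.getElem_inj_iff).1 (hjb.trans hb)
      omega
    have hBd : ∀ v ∈ B, d b ≤ d v := by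
      intro v hv
      obtain ⟨j, hj, rfl⟩ := List.mem_iff_getElem.1 hv
      rw [List.getElem_take]
      rw [List.length_take] at hj
      exact List.pairwise_iff_getElem.1 hsort j i (by omega) hi (by omega)
    have hroot : ∀ v ∈ U, ρ v ∉ B := fun v hv hh => (hmem _).1 (hBl _ hh) ⟨hρU v hv, hρ v hv⟩
    classical
    let φ : MvPolynomial V K →ₐ[K] MvPolynomial V K := aeval fun v => if v ∈ B then c v else X v
    have hφ : ∀ v, φ (X v) = if v ∈ B then c v else X v := fun v => aeval_X _ _
    have hφρ : ∀ v ∈ U, φ (X (ρ v)) = X (ρ v) := fun v hv => by rw [hφ, if_neg (hroot v hv)]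
    have hφc : ∀ v, φ (c v) = c v := by
      intro v
      by_cases hv : v ∈ U
      · simp only [c, if_pos hv, hφρ v hv]
      · simp [c, hv]
    -- `π` is the substitution on vertices, and `e H` is the exponent of the image of the monomial
    -- of H.
    let π : V → V := fun v => if v ∈ B then ρ v else v
    let e : Finset V → V →₀ ℕ := fun H => ∑ v ∈ H, Finsupp.single (π v) 1
    have he : ∀ H w, e H w = (H.filter fun v => π v = w).card := by
      intro H w
      simp only [e, Finsupp.finsetSum_apply, Finsupp.single_apply, Finset.card_filter]
    have hmapI : (facetIdeal K D).map φ =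
        Ideal.span ((fun s => monomial s (1 : K)) '' (e '' facets D)) := by
      rw [facetIdeal, Ideal.map_span, Set.image_image, Set.image_image]
      congr 1
      refine Set.image_congr fun H hH => ?_
      simp only [monomialOf, map_prod, e, hφ, monomial_sum_one]
      refine Finset.prod_congr rfl fun v hv => ?_
      simp only [c, π, if_pos (hHU H hH hv), X]
      split_ifs <;> rfl
    refine mem_sup_of_mul_mem_sup φ (fun v hv => by rw [hφ, if_pos hv])
      (fun v hv => by rw [hφ, if_neg hv]) (fun v _ => hφc v) ?_ hf
    intro g hg
    rw [map_sub, hφc, hφ, if_neg hbB] at hg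
    rw [hmapI] at hg ⊢
    by_cases hbU : b ∈ U
    · have hne : ρ b ≠ b := fun h => (hmem b).1 hbl ⟨hbU, h⟩
      simp only [c, if_pos hbU] at hg
      have hπb : ∀ v ∈ U, π v = b → v = b := by
        intro v hv h
        by_cases hvB : v ∈ B
        · simp only [π, if_pos hvB] at h
          exact absurd (by rw [← h]; exact hρ v hv) hne
        · simpa only [π, if_neg hvB] using h
      -- The bound counts the root together with all vertices merged into it so far; a facet through
      -- b contains all of them.
      refine mem_of_X_sub_X_mul_mem hne (U.filter fun v => π v = ρ b).card ?_ ?_ ?_ hg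
      · rintro _ ⟨H, hH, rfl⟩
        rw [he, Finset.card_le_one]
        intro v hv w hw
        rw [Finset.mem_filter] at hv hw
        rw [hπb v (hHU H hH hv.1) hv.2, hπb w (hHU H hH hw.1) hw.2]
      · rintro _ ⟨H, hH, rfl⟩
        rw [he]
        exact Finset.card_le_card (Finset.filter_subset_filter _ (hHU H hH))
      · rintro _ ⟨H, hH, rfl⟩ hne0
        rw [he] at hne0 ⊢
        obtain ⟨v, hv⟩ := Finset.card_ne_zero.1 hne0
        rw [Finset.mem_filter] at hv
        have hbH : b ∈ H := hπb v (hHU H hH hv.1) hv.2 ▸ hv.1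
        refine Finset.card_le_card fun w hw => ?_
        rw [Finset.mem_filter] at hw ⊢
        refine ⟨?_, hw.2⟩
        by_cases hwB : w ∈ B
        · have h2 := hw.2
          simp only [π, if_pos hwB] at h2
          exact hd w hw.1 b hbU h2 (hBd w hwB) H hH hbH
        · have h2 := hw.2
          simp only [π, if_neg hwB] at h2
          subst h2
          exact hd _ hw.1 b hbU (hρ b hbU) (hdρ b hbU) H hH hbH
    · simp only [c, if_neg hbU, sub_zero] at hg
      refine mem_of_X_mul_mem ?_ hg
      rintro _ ⟨H, hH, rfl⟩
      rw [he, Finset.card_eq_zero, Finset.filter_eq_empty_iff]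
      intro v hv h
      by_cases hvB : v ∈ B
      · simp only [π, if_pos hvB] at h
        exact hbU (h ▸ hρU v (hHU H hH hv))
      · simp only [π, if_neg hvB] at h
        exact hbU (h ▸ hHU H hH hv)
  · rw [List.length_map, hlen]

/-- Within a block the sets of facets through its vertices are nested, so counting facets (`d`)
orders them by inclusion, and a vertex of largest count serves as root. At most |L| vertices are
roots, so the regular sequence is long enough to reach the dimension bound; a minimal cover gives
depth ≤ dimension. -/
theorem isCohenMacaulayQuotient_of_isGrafting [DecidableEq V] [Fintype V]
    {D : PreAbstractSimplicialComplex V} {S L : Finset (Finset V)}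
    (hS : (S : Set (Finset V)) = facets D)
    (h : IsGrafting S L) : IsCohenMacaulayQuotient (facetIdeal K D) := by
  have hmemS : ∀ H, H ∈ S ↔ H ∈ facets D := fun H => by rw [← hS, Finset.mem_coe]
  let d : V → ℕ := fun v => (S.filter fun H => v ∈ H).card
  have hne : ∀ F ∈ L, ∃ r ∈ F, ∀ w ∈ F, d w ≤ d r := fun F hF =>
    F.exists_max_image d (D.isRelLowerSet_faces ((hmemS F).1 (h.subset hF)).1).1
  choose r hr hrmax using hne
  have huniq : ∀ A ∈ L, ∀ B ∈ L, ∀ v ∈ A, v ∈ B → A = B := fun A hA B hB v hvA hvB =>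
    h.disjoint.elim hA hB (Finset.not_disjoint_iff.2 ⟨v, hvA, hvB⟩)
  let ρ : V → V := fun v => if hv : ∃ F ∈ L, v ∈ F then r hv.choose hv.choose_spec.1 else v
  have hρ : ∀ F (hF : F ∈ L), ∀ v ∈ F, ρ v = r F hF := by
    intro F hF v hv
    have hex : ∃ F ∈ L, v ∈ F := ⟨F, hF, hv⟩
    have hch := huniq _ hex.choose_spec.1 F hF v hex.choose_spec.2 hv
    simp only [ρ, dif_pos hex]
    congr
  let U : Finset V := L.biUnion id
  have hU : ∀ v, v ∈ U ↔ ∃ F ∈ L, v ∈ F := fun v => by simp [U]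
  have hchain : ∀ F ∈ L, ∀ v ∈ F, ∀ w ∈ F, d w ≤ d v → ∀ H ∈ S, w ∈ H → v ∈ H := by
    intro F hF v hv w hw hdw H hH hwH
    by_contra hvH
    have hsub : (S.filter fun H => v ∈ H) ⊆ S.filter fun H => w ∈ H := by
      intro A hA
      rw [Finset.mem_filter] at hA ⊢
      refine ⟨hA.1, ?_⟩
      rcases h.chain F hF A hA.1 H hH with hc | hc
      · exact absurd (hc (Finset.mem_inter.2 ⟨hv, hA.2⟩)) hvH
      · exact hc (Finset.mem_inter.2 ⟨hw, hwH⟩)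
    have heq := Finset.eq_of_subset_of_card_le hsub hdw
    have : H ∈ S.filter fun H => v ∈ H := by
      rw [heq]; exact Finset.mem_filter.2 ⟨hH, hwH⟩
    exact hvH (Finset.mem_filter.1 this).2
  obtain ⟨rs, hrs, hreg, hlen⟩ := exists_isRegular (K := K) (D := D) U ρ d
    (fun v hv => by
      obtain ⟨F, hF, hvF⟩ := (hU v).1 hv
      rw [hρ F hF v hvF]
      exact (hU _).2 ⟨F, hF, hr F hF⟩)
    (fun v hv => by
      obtain ⟨F, hF, hvF⟩ := (hU v).1 hv
      rw [hρ F hF v hvF, hρ F hF _ (hr F hF)])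
    (fun H hH v hv => (hU v).2 (h.cover H ((hmemS H).2 hH) v hv))
    (fun v hv => by
      obtain ⟨F, hF, hvF⟩ := (hU v).1 hv
      rw [hρ F hF v hvF]
      exact hrmax F hF v hvF)
    (fun v hv w hw hvw hdw H hH hwH => by
      obtain ⟨F, hF, hvF⟩ := (hU v).1 hv
      obtain ⟨G, hG, hwG⟩ := (hU w).1 hw
      rw [hρ F hF v hvF, hρ G hG w hwG] at hvw
      obtain rfl := huniq F hF G hG _ (hr F hF) (hvw ▸ hr G hG)
      exact hchain F hF v hvF w hwG hdw H ((hmemS H).2 hH) hwH)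
  have hroots : (Finset.univ.filter fun v => v ∈ U ∧ ρ v = v).card ≤ L.card := by
    calc _ ≤ (L.attach.image fun F => r F.1 F.2).card := by
          refine Finset.card_le_card fun v hv => ?_
          simp only [Finset.mem_filter, Finset.mem_univ, true_and] at hv
          obtain ⟨F, hF, hvF⟩ := (hU v).1 hv.1
          exact Finset.mem_image.2 ⟨⟨F, hF⟩, Finset.mem_attach _ _, by
            rw [← hρ F hF v hvF, hv.2]⟩
      _ ≤ L.card := Finset.card_image_le.trans (Finset.card_attach).le
  have hsum := Finset.card_filter_add_card_filter_not (s := (Finset.univ : Finset V))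
    (fun v => v ∈ U ∧ ρ v = v)
  rw [Finset.card_univ] at hsum
  have hle : ringKrullDim (MvPolynomial V K ⧸ facetIdeal K D) ≤ depthQuotient (facetIdeal K D) := by
    refine (ringKrullDim_quotient_facetIdeal_le (L := L) (fun F hF => (hmemS F).1 (h.subset hF))
      h.disjoint).trans (le_trans ?_ (le_iSup₂_of_le rs ⟨hrs, hreg⟩ le_rfl))
    rw [Nat.card_eq_fintype_card, hlen]
    exact WithBot.coe_le_coe.2 (Nat.cast_le (α := ℕ∞).2 (by omega))
  refine le_antisymm ?_ hle
  obtain ⟨C, hC, hmin, -⟩ := exists_minimal_cover_disjoint (S := S) (T := ∅) (by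
    intro H hH hsub
    obtain ⟨v, hv⟩ := (D.isRelLowerSet_faces ((hmemS H).1 hH).1).1
    simpa using hsub hv)
  simp only [hmemS] at hC hmin
  exact (depthQuotient_facetIdeal_le (C := (C : Set V)) hC hmin).trans
    (le_ringKrullDim_quotient_facetIdeal (C := (C : Set V)) hC)

end FacetComplex

/-! ### Components, subcomplexes and leaves of forests. -/

namespace FacetComplex

section Forest

variable {V : Type*}

theorem facets_generated {D : PreAbstractSimplicialComplex V} {S : Set (Finset V)}
    (hS : S ⊆ facets D) : facets (generated S) = S := by
  ext A
  constructor
  · rintro ⟨⟨hA, B, hB, hAB⟩, hmax⟩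
    have : B ⊆ A := hmax (y := B) ⟨hA.mono hAB, B, hB, subset_rfl⟩ hAB
    rwa [Finset.Subset.antisymm hAB this]
  · intro hA
    refine ⟨⟨(D.isRelLowerSet_faces (hS hA).1).1, A, hA, subset_rfl⟩, ?_⟩
    rintro B ⟨_, C, hC, hBC⟩ hAB
    exact hBC.trans ((hS hA).2 (hS hC).1 (le_trans hAB hBC))

theorem exists_facet_superset [Finite V] {D : PreAbstractSimplicialComplex V} {s : Finset V}
    (hs : s ∈ D.faces) : ∃ F ∈ facets D, s ⊆ F := by
  have : Fintype V := Fintype.ofFinite V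
  obtain ⟨F, hsF, hF⟩ := exists_maximal_ge_of_wellFoundedGT (fun s => s ∈ D.faces) s hs
  exact ⟨F, hF, hsF⟩

theorem eq_of_facet_subset {D : PreAbstractSimplicialComplex V} {A B : Finset V}
    (hA : A ∈ facets D) (hB : B ∈ facets D) (h : A ⊆ B) : A = B :=
  Finset.Subset.antisymm h (hA.2 hB.1 h)

theorem nonempty_of_facet {D : PreAbstractSimplicialComplex V} {A : Finset V}
    (hA : A ∈ facets D) : A.Nonempty :=
  (D.isRelLowerSet_faces hA.1).1

variable [DecidableEq V]

/-- The component consists of the facets reachable from F₀. A connected subcomplex containing it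
still has F₀ as a facet, so its facets are all reachable. -/
theorem exists_component [Finite V] {D : PreAbstractSimplicialComplex V} {F₀ : Finset V}
    (hF₀ : F₀ ∈ facets D) : ∃ G, IsComponent G D ∧ IsSubcomplex G D ∧ F₀ ∈ facets G ∧
      ∀ A ∈ facets G, ∀ B ∈ facets D, (A ∩ B).Nonempty → B ∈ facets G := by
  let r : PreAbstractSimplicialComplex V → Finset V → Finset V → Prop :=
    fun D A B => B ∈ facets D ∧ (A ∩ B).Nonempty
  let S : Set (Finset V) := {B | B ∈ facets D ∧ Relation.ReflTransGen (r D) F₀ B}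
  have hS : S ⊆ facets D := fun B hB => hB.1
  have hfac : facets (generated S) = S := facets_generated hS
  have hpath : ∀ B, Relation.ReflTransGen (r D) F₀ B → B ∈ S ∧
      Relation.ReflTransGen (r (generated S)) F₀ B ∧
      Relation.ReflTransGen (r (generated S)) B F₀ := by
    intro B hB
    induction hB with
    | refl => exact ⟨⟨hF₀, .refl⟩, .refl, .refl⟩
    | @tail A B hA hAB ih =>
      have hBS : B ∈ S := ⟨hAB.1, hA.tail hAB⟩
      refine ⟨hBS, ih.2.1.tail ⟨hfac.symm.subset hBS, hAB.2⟩,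
        ih.2.2.head ⟨hfac.symm.subset ih.1, ?_⟩⟩
      rw [Finset.inter_comm]
      exact hAB.2
  have hF₀S : F₀ ∈ S := ⟨hF₀, .refl⟩
  refine ⟨generated S, ⟨⟨hfac.trans_subset hS, ⟨F₀, hfac.symm.subset hF₀S⟩, ?_⟩, ?_⟩,
    hfac.trans_subset hS, hfac.symm.subset hF₀S, ?_⟩
  · intro A hA B hB
    rw [hfac] at hA hB
    exact (hpath A hA.2).2.2.trans (hpath B hB.2).2.1
  · rintro C ⟨hCD, -, hCc⟩ hle s hs
    have hF₀C : F₀ ∈ facets C := by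
      refine ⟨hle ⟨nonempty_of_facet hF₀, F₀, hF₀S, subset_rfl⟩, fun t ht hFt => ?_⟩
      obtain ⟨B, hB, htB⟩ := exists_facet_superset ht
      exact htB.trans (hF₀.2 (hCD hB).1 (le_trans hFt htB))
    obtain ⟨B, hB, hsB⟩ := exists_facet_superset hs
    refine ⟨(C.isRelLowerSet_faces hs).1, B, ⟨hCD hB, ?_⟩, hsB⟩
    exact Relation.ReflTransGen.mono (fun X Y hXY => ⟨hCD hXY.1, hXY.2⟩) _ _ (hCc F₀ hF₀C B hB)
  · intro A hA B hB hAB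
    rw [hfac] at hA ⊢
    exact ⟨hB, hA.2.tail ⟨hB, hAB⟩⟩

/-- A leaf of the part of T inside one component remains a leaf of T, because members outside the
component are disjoint from it. -/
theorem IsForest.hasLeaves [Finite V] {D : PreAbstractSimplicialComplex V} (h : IsForest D)
    {S : Finset (Finset V)} (hS : (S : Set (Finset V)) ⊆ facets D) : HasLeaves S := by
  intro T hT hTne
  obtain ⟨F₀, hF₀⟩ := hTne
  have hTD : ∀ A ∈ T, A ∈ facets D := fun A hA => hS (hT hA)
  obtain ⟨G, hG, hGD, hF₀G, hGc⟩ := exists_component (hTD F₀ hF₀)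
  have hfac : facets (generated (↑T ∩ facets G)) = ↑T ∩ facets G :=
    facets_generated (D := D) fun A hA => hTD A hA.1
  obtain ⟨F, hF, hleaf⟩ := (h G hG).2 (generated (↑T ∩ facets G))
    (hfac.trans_subset Set.inter_subset_right) ⟨F₀, hfac.symm.subset ⟨hF₀, hF₀G⟩⟩
  rw [hfac] at hF hleaf
  refine ⟨F, hF.1, ?_⟩
  have hfar : ∀ H ∈ T, H ∉ facets G → F ∩ H = ∅ := by
    intro H hH hHG
    by_contra hne
    exact hHG (hGc F hF.2 H (hTD H hH) (Finset.nonempty_iff_ne_empty.2 hne))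
  rcases hleaf with honly | ⟨A, hA, hAF, hjoint⟩
  · by_cases hall : ∀ H ∈ T, H = F
    · exact Or.inl hall
    · push Not at hall
      obtain ⟨A, hA, hAF⟩ := hall
      -- All other members are disjoint from F, so any of them serves as a joint.
      refine Or.inr ⟨A, hA, hAF, fun H hH hHF => ?_⟩
      rw [hfar H hH fun hHG => hHF ?_]
      · exact Finset.empty_subset _
      · have : H ∈ (↑T ∩ facets G : Set (Finset V)) := ⟨hH, hHG⟩
        rwa [honly] at this
  · refine Or.inr ⟨A, hA.1, hAF, fun H hH hHF => ?_⟩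
    by_cases hHG : H ∈ facets G
    · exact (hjoint H ⟨hH, hHG⟩ hHF).trans Finset.inter_subset_right
    · rw [hfar H hH hHG]
      exact Finset.empty_subset _

theorem IsForest.of_isSubcomplex [Finite V] {D D' : PreAbstractSimplicialComplex V}
    (h : IsForest D) (hD' : IsSubcomplex D' D) : IsForest D' := by
  intro G hG
  refine ⟨hG.1.2.2, fun E hE hne => ?_⟩
  have hED : facets E ⊆ facets D := fun A hA => hD' (hG.1.1 (hE hA))
  have hfin : (facets E).Finite := Set.toFinite _
  have hmem : ∀ A, A ∈ hfin.toFinset ↔ A ∈ facets E := fun A => hfin.mem_toFinset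
  obtain ⟨F, hF, hl⟩ := (h.hasLeaves (S := hfin.toFinset) (by simpa using hED)) _ subset_rfl
    (by simpa using hne)
  refine ⟨F, (hmem F).1 hF, ?_⟩
  simp only [hmem] at hl hF
  rcases hl with hl | ⟨A, hA, hAF, hl⟩
  · exact Or.inl (Set.eq_singleton_iff_unique_mem.2 ⟨hF, hl⟩)
  · exact Or.inr ⟨A, hA, hAF, fun H hH hHF =>
      Finset.subset_inter Finset.inter_subset_left (hl H hH hHF)⟩

/-- Cohen-Macaulay simplicial forests are grafted. -/
theorem IsCohenMacaulayForest.exists_isGrafting [Fintype V] {K : Type*} [Field K]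
    {D : PreAbstractSimplicialComplex V} (h : IsCohenMacaulayForest K D) {S : Finset (Finset V)}
    (hS : (S : Set (Finset V)) = facets D) : ∃ L, IsGrafting S L := by
  have hmem : ∀ A, A ∈ S ↔ A ∈ facets D := fun A => by rw [← hS, Finset.mem_coe]
  refine (h.1.hasLeaves hS.subset).exists_isGrafting (fun H hH => nonempty_of_facet ((hmem H).1 hH))
    (fun A hA B hB => eq_of_facet_subset ((hmem A).1 hA) ((hmem B).1 hB)) ?_
  intro C C' hC hmin hC'
  simp only [hmem] at hC hmin hC'
  have := h.2.ncard_le (C := (C : Set V)) (C' := (C' : Set V)) hC hmin hC'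
  simpa only [Set.ncard_coe_finset] using this

/-- A vertex of F outside its joint lies in no other facet, so the block covering it is F. -/
theorem IsLeaf.mem_of_isGrafting {D : PreAbstractSimplicialComplex V} {F : Finset V}
    (hF : IsLeaf D F) {S L : Finset (Finset V)} (hS : (S : Set (Finset V)) = facets D)
    (h : IsGrafting S L) : F ∈ L := by
  have hmem : ∀ A, A ∈ S ↔ A ∈ facets D := fun A => by rw [← hS, Finset.mem_coe]
  obtain ⟨v, hv, hfree⟩ : ∃ v ∈ F, ∀ H ∈ facets D, v ∈ H → H = F := by
    rcases hF.2 with honly | ⟨G, hG, hGF, hjoint⟩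
    · obtain ⟨v, hv⟩ := nonempty_of_facet hF.1
      exact ⟨v, hv, fun H hH _ => by rwa [honly] at hH⟩
    · obtain ⟨v, hv, hvG⟩ := Finset.not_subset.1 fun hs => hGF (eq_of_facet_subset hF.1 hG hs).symm
      refine ⟨v, hv, fun H hH hvH => ?_⟩
      by_contra hHF
      exact hvG (Finset.mem_inter.1 (hjoint H hH hHF (Finset.mem_inter.2 ⟨hv, hvH⟩))).2
  obtain ⟨A, hA, hvA⟩ := h.cover F ((hmem F).2 hF.1) v hv
  rwa [← hfree A ((hmem A).1 (h.subset hA)) hvA]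

end Forest

theorem mem_facets_deleteClosedNeighborhood {V : Type*} [DecidableEq V]
    {D : PreAbstractSimplicialComplex V} {F : Finset V} (hF : F.Nonempty) {H : Finset V} :
    H ∈ facets (deleteClosedNeighborhood D F) ↔ H ∈ facets D ∧ Disjoint H F := by
  rw [facets_deleteClosedNeighborhood, Set.mem_sdiff]
  refine and_congr_right fun hH => ?_
  simp only [closedNeighborhood, Set.mem_ofPred_eq, hH, true_and, not_or,
    Finset.not_nonempty_iff_eq_empty, Finset.disjoint_iff_inter_eq_empty]
  refine and_iff_right_of_imp ?_
  rintro h rfl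
  rw [Finset.inter_self] at h
  exact hF.ne_empty h

theorem isGrafting_deleteClosedNeighborhood {V : Type*} [DecidableEq V]
    {S L : Finset (Finset V)} {F : Finset V} (h : IsGrafting S L) (hF : F ∈ L) :
    IsGrafting (S.filter fun H => Disjoint H F) (L.erase F) where
  subset := fun A hA => Finset.mem_filter.2 ⟨h.subset (Finset.mem_of_mem_erase hA),
    h.disjoint (Finset.mem_of_mem_erase hA) hF (Finset.ne_of_mem_erase hA)⟩
  disjoint := h.disjoint.subset (Finset.coe_subset.2 (Finset.erase_subset _ _))
  cover := by
    intro H hH v hv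
    rw [Finset.mem_filter] at hH
    obtain ⟨A, hA, hvA⟩ := h.cover H hH.1 v hv
    refine ⟨A, Finset.mem_erase.2 ⟨?_, hA⟩, hvA⟩
    rintro rfl
    exact Finset.disjoint_left.1 hH.2 hv hvA
  chain := fun A hA H₁ h₁ H₂ h₂ => h.chain A (Finset.mem_of_mem_erase hA)
    H₁ (Finset.mem_filter.1 h₁).1 H₂ (Finset.mem_filter.1 h₂).1

/-! ### Square-free powers, matchings and the colon formula. -/

section SquarefreePower

variable {V K : Type*} [Field K]

/-- The exponent vector of the square-free monomial on `S`. -/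
noncomputable def exponentOf (S : Finset V) : V →₀ ℕ :=
  Finsupp.indicator S fun _ _ => 1

theorem exponentOf_of_mem {S : Finset V} {v : V} (h : v ∈ S) : exponentOf S v = 1 := by
  classical simp [exponentOf, h]

theorem exponentOf_of_notMem {S : Finset V} {v : V} (h : v ∉ S) : exponentOf S v = 0 := by
  classical simp [exponentOf, h]

theorem exponentOf_le_iff {S : Finset V} {u : V →₀ ℕ} :
    exponentOf S ≤ u ↔ ∀ v ∈ S, u v ≠ 0 := by
  constructor
  · intro h v hv
    have := h v
    rw [exponentOf_of_mem hv] at this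
    omega
  · intro h v
    by_cases hv : v ∈ S
    · rw [exponentOf_of_mem hv]
      exact Nat.one_le_iff_ne_zero.2 (h v hv)
    · rw [exponentOf_of_notMem hv]
      exact Nat.zero_le _

theorem facetIdeal_pow_le (D : PreAbstractSimplicialComplex V) (k : ℕ) :
    facetIdeal K D ^ k ≤ Ideal.span ((fun s => monomial s (1 : K)) ''
      {m | ∃ l : List (Finset V), l.length = k ∧ (∀ H ∈ l, H ∈ facets D) ∧
        m = (l.map exponentOf).sum}) := by
  induction k with
  | zero =>
    rw [pow_zero, Ideal.one_eq_top]
    refine ((Ideal.eq_top_iff_one _).2 (Ideal.subset_span ?_)).ge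
    exact ⟨0, ⟨[], rfl, by simp, by simp⟩, rfl⟩
  | succ k ih =>
    rw [pow_succ]
    refine (Ideal.mul_mono_left ih).trans ?_
    rw [facetIdeal, Ideal.span_mul_span', Ideal.span_le]
    rintro _ ⟨_, ⟨_, ⟨l, hl, hlD, rfl⟩, rfl⟩, _, ⟨H, hH, rfl⟩, rfl⟩
    refine Ideal.subset_span ⟨_, ⟨H :: l, by simp [hl], ?_, rfl⟩, ?_⟩
    · intro A hA
      rcases List.mem_cons.1 hA with rfl | hA
      · exact hH
      · exact hlD A hA
    · simp only [List.map_cons, List.sum_cons, monomialOf_eq, monomial_mul, mul_one]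
      rw [add_comm]
      rfl

/-- A product dividing a square-free monomial repeats no variable, so its factors are disjoint and,
being nonempty sets, distinct. -/
theorem exists_matching_of_sum_le [DecidableEq V] (l : List (Finset V)) :
    ∀ S : Finset V, (∀ H ∈ l, H.Nonempty) → (l.map exponentOf).sum ≤ exponentOf S →
      ∃ M : Finset (Finset V), (∀ H ∈ M, H ∈ l ∧ H ⊆ S) ∧
        (M : Set (Finset V)).PairwiseDisjoint id ∧ M.card = l.length := by
  induction l with
  | nil => exact fun S _ _ => ⟨∅, by simp, by simp, rfl⟩
  | cons A l ih =>
    intro S hne hsum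
    rw [List.map_cons, List.sum_cons] at hsum
    obtain ⟨M, hM, hMd, hcard⟩ := ih (S \ A) (fun H hH => hne H (by simp [hH])) (by
      intro v
      have h := hsum v
      rw [Finsupp.add_apply] at h
      by_cases hvA : v ∈ A
      · have hS : exponentOf S v ≤ 1 := by
          by_cases hvS : v ∈ S
          · rw [exponentOf_of_mem hvS]
          · rw [exponentOf_of_notMem hvS]; exact zero_le_one
        rw [exponentOf_of_mem hvA] at h
        omega
      · by_cases hvS : v ∈ S
        · rw [exponentOf_of_mem hvS] at h
          rw [exponentOf_of_mem (Finset.mem_sdiff.2 ⟨hvS, hvA⟩)]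
          omega
        · rw [exponentOf_of_notMem hvS] at h
          omega)
    have hd : ∀ H ∈ M, Disjoint A H := fun H hH =>
      Finset.disjoint_of_subset_right (hM H hH).2 Finset.disjoint_sdiff
    have hAM : A ∉ M := fun hA => (hne A (by simp)).ne_empty (disjoint_self.1 (hd A hA))
    refine ⟨insert A M, ?_, ?_, by rw [Finset.card_insert_of_notMem hAM, hcard, List.length_cons]⟩
    · intro H hH
      rcases Finset.mem_insert.1 hH with rfl | hH
      · refine ⟨by simp, fun v hv => ?_⟩
        have h := hsum v
        rw [Finsupp.add_apply, exponentOf_of_mem hv] at h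
        by_contra hvS
        rw [exponentOf_of_notMem hvS] at h
        omega
      · exact ⟨by simp [(hM H hH).1], (hM H hH).2.trans Finset.sdiff_subset⟩
    · rw [Finset.coe_insert, Set.pairwiseDisjoint_insert_of_notMem (by simpa using hAM)]
      exact ⟨hMd, hd⟩

theorem monomialOf_mem_facetIdeal_pow [DecidableEq V] {D : PreAbstractSimplicialComplex V}
    {S : Finset V} {k : ℕ} :
    monomialOf K S ∈ facetIdeal K D ^ k ↔ ∃ M : Finset (Finset V),
      (M : Set (Finset V)) ⊆ facets D ∧ (M : Set (Finset V)).PairwiseDisjoint id ∧ M.card = k ∧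
      ∀ H ∈ M, H ⊆ S := by
  constructor
  · intro h
    have := mem_ideal_span_monomial_image.1 (facetIdeal_pow_le D k h) (exponentOf S) (by
      rw [monomialOf_eq, mem_support_iff]
      simp [exponentOf])
    obtain ⟨_, ⟨l, rfl, hl, rfl⟩, hle⟩ := this
    obtain ⟨M, hM, hMd, hcard⟩ := exists_matching_of_sum_le l S
      (fun H hH => nonempty_of_facet (hl H hH)) hle
    exact ⟨M, fun H hH => hl H (hM H hH).1, hMd, hcard, fun H hH => (hM H hH).2⟩
  · rintro ⟨M, hM, hMd, rfl, hMS⟩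
    have hprod : ∏ H ∈ M, monomialOf K H ∈ facetIdeal K D ^ M.card := by
      rw [← Finset.prod_const]
      exact Ideal.prod_mem_prod fun H hH => Ideal.subset_span ⟨H, hM hH, rfl⟩
    have heq : ∏ H ∈ M, monomialOf K H = monomialOf K (M.biUnion id) :=
      (Finset.prod_biUnion hMd).symm
    rw [heq] at hprod
    exact Ideal.mem_of_dvd _ (monomialOf_dvd (Finset.biUnion_subset.2 hMS)) hprod

/-- Membership in a monomial ideal is tested on each exponent, which turns the colon formula into a
statement about matchings. -/
theorem mem_squarefreePower_iff [DecidableEq V] {D : PreAbstractSimplicialComplex V} {k : ℕ}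
    {f : MvPolynomial V K} :
    f ∈ squarefreePower (facetIdeal K D) k ↔ ∀ u ∈ f.support, ∃ M : Finset (Finset V),
      (M : Set (Finset V)) ⊆ facets D ∧ (M : Set (Finset V)).PairwiseDisjoint id ∧ M.card = k ∧
      ∀ H ∈ M, ∀ v ∈ H, u v ≠ 0 := by
  have hset : {p : MvPolynomial V K | p ∈ facetIdeal K D ^ k ∧ ∃ S : Finset V, p = monomialOf K S} =
      (fun s => monomial s (1 : K)) ''
        (exponentOf '' {S | monomialOf K S ∈ facetIdeal K D ^ k}) := by
    ext p
    constructor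
    · rintro ⟨hp, S, rfl⟩
      exact ⟨_, ⟨S, hp, rfl⟩, (monomialOf_eq S).symm⟩
    · rintro ⟨_, ⟨S, hS, rfl⟩, rfl⟩
      have heq : monomial (exponentOf S) (1 : K) = monomialOf K S := (monomialOf_eq S).symm
      exact ⟨show monomial (exponentOf S) (1 : K) ∈ _ from heq.symm ▸ hS, S, heq⟩
  rw [squarefreePower, hset, mem_ideal_span_monomial_image]
  refine forall₂_congr fun u _ => ?_
  constructor
  · rintro ⟨_, ⟨S, hS, rfl⟩, hle⟩
    obtain ⟨M, hM, hMd, hcard, hMS⟩ := monomialOf_mem_facetIdeal_pow.1 hS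
    exact ⟨M, hM, hMd, hcard, fun H hH v hv => exponentOf_le_iff.1 hle v (hMS H hH hv)⟩
  · rintro ⟨M, hM, hMd, hcard, hu⟩
    refine ⟨_, ⟨M.biUnion id, monomialOf_mem_facetIdeal_pow.2 ⟨M, hM, hMd, hcard,
      fun H hH => Finset.subset_biUnion_of_mem id hH⟩, rfl⟩, exponentOf_le_iff.2 fun v hv => ?_⟩
    obtain ⟨H, hH, hvH⟩ := Finset.mem_biUnion.1 hv
    exact hu H hH v hvH

/-- The colon formula holds at every facet which at most one member of each matching meets. -/
theorem colon_squarefreePower [DecidableEq V] {D : PreAbstractSimplicialComplex V} {F : Finset V}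
    (hF : F ∈ facets D)
    (hchain : ∀ A ∈ facets D, ∀ B ∈ facets D, F ∩ A ⊆ B ∨ F ∩ B ⊆ A) {k : ℕ} (hk : 1 ≤ k) :
    (squarefreePower (facetIdeal K D) k).colon {monomialOf K F} =
      squarefreePower (facetIdeal K (deleteClosedNeighborhood D F)) (k - 1) := by
  have hFne := nonempty_of_facet hF
  have hmono : monomialOf K F = monomial (exponentOf F) 1 := monomialOf_eq F
  ext f
  rw [Submodule.mem_colon_singleton, smul_eq_mul, mem_squarefreePower_iff, mem_squarefreePower_iff,
    hmono]
  constructor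
  · intro h u hu
    obtain ⟨M, hM, hMd, rfl, hMu⟩ := h (u + exponentOf F) (by
      rw [mem_support_iff, coeff_mul_monomial, mul_one]
      exact mem_support_iff.1 hu)
    -- Nested nonempty traces on F share a vertex, so disjoint facets cannot both meet F.
    have hone : (M.filter fun H => ¬ Disjoint H F).card ≤ 1 := by
      rw [Finset.card_le_one]
      intro A hA B hB
      rw [Finset.mem_filter, Finset.not_disjoint_iff] at hA hB
      obtain ⟨hA, a, haA, haF⟩ := hA
      obtain ⟨hB, b, hbB, hbF⟩ := hB
      refine hMd.elim hA hB (Finset.not_disjoint_iff.2 ?_)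
      rcases hchain A (hM hA) B (hM hB) with hc | hc
      · exact ⟨a, haA, hc (Finset.mem_inter.2 ⟨haF, haA⟩)⟩
      · exact ⟨b, hc (Finset.mem_inter.2 ⟨hbF, hbB⟩), hbB⟩
    have hsum := Finset.card_filter_add_card_filter_not (s := M) (fun H => Disjoint H F)
    -- If no member of M meets F, an arbitrary one is dropped to reach exactly k - 1.
    obtain ⟨N, hN, hcard⟩ := Finset.exists_subset_card_eq
      (s := M.filter fun H => Disjoint H F) (n := M.card - 1) (by omega)
    have hN' : ∀ H ∈ N, H ∈ M ∧ Disjoint H F := fun H hH => Finset.mem_filter.1 (hN hH)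
    refine ⟨N, fun H hH => ?_, hMd.subset fun H hH => (hN' H hH).1, hcard, fun H hH v hv => ?_⟩
    · exact (mem_facets_deleteClosedNeighborhood hFne).2 ⟨hM (hN' H hH).1, (hN' H hH).2⟩
    · have := hMu H (hN' H hH).1 v hv
      rwa [Finsupp.add_apply, exponentOf_of_notMem
        (Finset.disjoint_left.1 (hN' H hH).2 hv), add_zero] at this
  · intro h u hu
    rw [mem_support_iff, coeff_mul_monomial', mul_one] at hu
    split_ifs at hu with hle
    · obtain ⟨N, hN, hNd, hcard, hNu⟩ := h _ (mem_support_iff.2 hu)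
      have hN' := fun H (hH : H ∈ N) => (mem_facets_deleteClosedNeighborhood hFne).1 (hN hH)
      have hFN : F ∉ N := fun hh => hFne.ne_empty (disjoint_self.1 (hN' F hh).2)
      refine ⟨insert F N, ?_, ?_, ?_, ?_⟩
      · rw [Finset.coe_insert]
        exact Set.insert_subset hF fun H hH => (hN' H hH).1
      · rw [Finset.coe_insert, Set.pairwiseDisjoint_insert_of_notMem (by simpa using hFN)]
        exact ⟨hNd, fun H hH => (hN' H hH).2.symm⟩
      · rw [Finset.card_insert_of_notMem hFN, hcard]
        omega
      · intro H hH v hv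
        rcases Finset.mem_insert.1 hH with rfl | hH
        · exact exponentOf_le_iff.1 hle v hv
        · have := hNu H hH v hv
          rw [Finsupp.tsub_apply] at this
          omega
    · exact absurd rfl hu

end SquarefreePower

end FacetComplex

theorem lemma3p1 {V : Type*} [Fintype V] [DecidableEq V] (K : Type*) [Field K]
    (D : PreAbstractSimplicialComplex V) (hD : FacetComplex.IsCohenMacaulayForest K D)
    (F : Finset V) (hF : FacetComplex.IsLeaf D F) :
    (∀ k : ℕ, 1 ≤ k → k ≤ FacetComplex.matchingNumber D →
      (FacetComplex.squarefreePower (FacetComplex.facetIdeal K D) k).colon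
          {FacetComplex.monomialOf K F} =
        FacetComplex.squarefreePower
          (FacetComplex.facetIdeal K (FacetComplex.deleteClosedNeighborhood D F)) (k - 1)) ∧
    FacetComplex.IsCohenMacaulayForest K (FacetComplex.deleteClosedNeighborhood D F) := by
  classical
  have hfin : (FacetComplex.facets D).Finite := Set.toFinite _
  have hS : (hfin.toFinset : Set (Finset V)) = FacetComplex.facets D := hfin.coe_toFinset
  have hFne := FacetComplex.nonempty_of_facet hF.1
  obtain ⟨L, hL⟩ := hD.exists_isGrafting hS
  have hFL := hF.mem_of_isGrafting hS hL
  refine ⟨fun k hk _ => FacetComplex.colon_squarefreePower hF.1 (fun A hA B hB =>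
    hL.chain F hFL A (hfin.mem_toFinset.2 hA) B (hfin.mem_toFinset.2 hB)) hk,
    hD.1.of_isSubcomplex fun H hH =>
      ((FacetComplex.mem_facets_deleteClosedNeighborhood hFne).1 hH).1,
    FacetComplex.isCohenMacaulayQuotient_of_isGrafting ?_
      (FacetComplex.isGrafting_deleteClosedNeighborhood hL hFL)⟩
  ext H
  rw [FacetComplex.mem_facets_deleteClosedNeighborhood hFne, Finset.mem_coe, Finset.mem_filter,
    hfin.mem_toFinset]
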